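/- Let $\mathbb{F}_q$ be a finite field with $q$ elements, let $X$ be a smooth, projective, geometrically irreducible curve over $\mathbb{F}_q$, $\infty\in X$ a closed point, and $\mathbf{A}=\Gamma(X\smallsetminus\{\infty\},\mathcal{O}_X)$. Let $E$ be a field with an $\mathbb{F}_q$-algebra homomorphism $\iota:\mathbf{A}\to E$, let $E^{\mathrm{sep}}$ be a separable closure of $E$ and $G=\operatorname{Gal}(E^{\mathrm{sep}}/E)$. Put $\mathbf{A}_E=\mathbf{A}\otimes_{\mathbb{F}_q}E$, with the twist $b\mapsto b^{(1)}$, $(a\otimes x)^{(1)}=a\otimes x^q$, and let $\mathfrak{j}\subset\mathbf{A}_E$ be the ideal generated by all $a\otimes 1-1\otimes\iota(a)$, $a\in\mathbf{A}$. Let $E[\tau]$ be the twisted polynomial ring, $\tau x=x^q\tau$. Definitions. An effective abelian $\mathbf{A}$-motive of rank $s$ over $E$ is a finitely generated projective $\mathbf{A}_E$-module $M$ of constant rank $s$ with an additive map $\tau:M\to M$, $\tau(bm)=b^{(1)}\tau(m)$, whose linearization $\tau^*M\to M$ becomes an isomorphism after inverting $\mathfrak{j}$. Isomorphisms are the $\mathbf{A}_E$-linear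 bijections commuting with $\tau$; tensor products are taken over $\mathbf{A}_E$ with $\tau(m\otimes m')=\tau m\otimes\tau m'$. An Anderson $\mathbf{A}$-module of dimension $N$ over $E$ (with underlying group $\mathbb{G}_a^N$) is an $\mathbb{F}_q$-algebra homomorphism $\mathcal{E}:\mathbf{A}\to\operatorname{Mat}_N(E[\tau])$, $a\mapsto \mathcal{E}_a$, such that for every $a$ the constant coefficient $\partial\mathcal{E}_a$ satisfies $(\partial\mathcal{E}_a-\iota(a))^N=0$. Put $\mathbb{M}(\mathcal{E})=\operatorname{Hom}_{\mathbb{F}_q}(\mathbb{G}_a^N,\mathbb{G}_a)=\operatorname{Mat}_{1\times N}(E[\tau])$ with $(a\otimes x)\cdot m=x\,m\,\mathcal{E}_a$ and $\tau\cdot m=\tau m$; $\mathcal{E}$ is abelian of rank $s$ if $\mathbb{M}(\mathcal{E})$ is finitely generated projective of constant rank $s$ over $\mathbf{A}_E$. A Drinfeld $\mathbf{A}$-module of rank $r$ is an abelian Anderson $\mathbf{A}$-module of dimension $1$ and rank $r$. For a finite-dimensional $\mathbb{F}_q$-vector space $V$ on which $G$ acts linearly through $\operatorname{Gal}(L/E)$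 for some finite Galois extension $L/E$ inside $E^{\mathrm{sep}}$, let $\mathbf{D}(V)=(E^{\mathrm{sep}}\otimes_{\mathbb{F}_q}V)^G$ ($G$ acting diagonally), with $\tau(x\otimes v)=x^q\otimes v$, let $\mathbb{M}(V)=\mathbf{D}(V)\otimes_E\mathbf{A}_E$ with $\tau(x\otimes b)=\tau(x)\otimes b^{(1)}$, and for a Drinfeld $\mathbf{A}$-module $\varphi$ over $E$ let $\mathbb{M}(\varphi,V)=\mathbb{M}(\varphi)\otimes\mathbb{M}(V)$. Theorem. Let $\varphi$ be a Drinfeld $\mathbf{A}$-module of rank $r$ over $E$. (1) Let $k$ be a finite extension of $\mathbb{F}_q$ of degree $d$, and $V$ a $k$-vector space of dimension $n$ on which $G$ acts $k$-linearly through the Galois group of a finite Galois extension of $E$ inside $E^{\mathrm{sep}}$; regard $V$ as an $\mathbb{F}_q$-vector space. Put $N=nd$. Then $\mathbb{M}(\varphi,V)$ is an effective abelian $\mathbf{A}$-motive of rank $rN$, and there is an abelian Anderson $\mathbf{A}$-module $\mathcal{E}$ over $E$, of dimension $N$ and rank $rN$, with $\mathbb{M}(\varphi,V)\cong\mathbb{M}(\mathcal{E})$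 over $E$. (2) Let $\rho:G\to\operatorname{GL}_n(\overline{\mathbb{F}}_q)$ be a homomorphism that factors through the Galois group of a finite Galois extension of $E$ inside $E^{\mathrm{sep}}$, let $\mathbb{F}_q(\rho)$ be the field generated over $\mathbb{F}_q$ by all entries of the matrices $\rho(g)$, $g\in G$, let $d=[\mathbb{F}_q(\rho):\mathbb{F}_q]$, $N=nd$, and let $V_\rho=\mathbb{F}_q(\rho)^n$ with $G$ acting through $\rho$. Then the conclusion of (1) holds for $V=V_\rho$, that is, for $\mathbb{M}(\varphi,\rho):=\mathbb{M}(\varphi,V_\rho)$. -/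

import Mathlib

open scoped TensorProduct

noncomputable section

universe u v w

/-! ### Frobenius and the ring `A_R`

`Fq` is a finite field with `q` elements and `frobeniusAlgHom Fq R` is `x ↦ x ^ q`.
The ring `A_R` is written `R ⊗[Fq] A`. -/

/-- The `q`-power Frobenius of an `Fq`-algebra, as a ring homomorphism. -/
def qFrob (Fq : Type*) [Field Fq] [Fintype Fq] (R : Type*) [CommRing R] [Algebra Fq R] : R →+* R :=
  (FiniteField.frobeniusAlgHom Fq R : R →+* R)

theorem qFrob_apply (Fq : Type*) [Field Fq] [Fintype Fq] (R : Type*) [CommRing R] [Algebra Fq R]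
    (x : R) : qFrob Fq R x = x ^ Fintype.card Fq := rfl

/-- The twist `r ⊗ a ↦ r ^ q ⊗ a` of `A_R`. -/
def twist (Fq : Type*) [Field Fq] [Fintype Fq] (A : Type*) [CommRing A] [Algebra Fq A]
    (R : Type*) [CommRing R] [Algebra Fq R] : (R ⊗[Fq] A) →+* (R ⊗[Fq] A) :=
  (Algebra.TensorProduct.map (FiniteField.frobeniusAlgHom Fq R) (AlgHom.id Fq A) :
    (R ⊗[Fq] A) →ₐ[Fq] (R ⊗[Fq] A))

theorem twist_tmul (Fq : Type*) [Field Fq] [Fintype Fq] (A : Type*) [CommRing A] [Algebra Fq A]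
    (R : Type*) [CommRing R] [Algebra Fq R] (x : R) (a : A) :
    twist Fq A R (x ⊗ₜ a) = (x ^ Fintype.card Fq) ⊗ₜ a := rfl

/-- The ideal `𝔧` of `A_R` generated by the elements `a ⊗ 1 - 1 ⊗ ι(a)`, where `ι : A → R` is the
structure map. -/
def idealJ (Fq : Type*) [Field Fq] (A : Type*) [CommRing A] [Algebra Fq A]
    (R : Type*) [CommRing R] [Algebra Fq R] [Algebra A R] : Ideal (R ⊗[Fq] A) :=
  Ideal.span (Set.range fun a : A => (1 : R) ⊗ₜ[Fq] a - (algebraMap A R a) ⊗ₜ[Fq] (1 : A))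

/-! ### The ring of functions on a curve that are regular outside a closed point -/

open AlgebraicGeometry CategoryTheory in
/-- `A` is isomorphic, as an `Fq`-algebra, to the ring of regular functions on `X ∖ {∞}`, where `X`
is a smooth, proper (equivalently, projective), geometrically irreducible curve over `Fq` and `∞`
is a closed point of `X`. -/
def IsCurveRing (Fq : Type u) [Field Fq] (A : Type v) [CommRing A] [Algebra Fq A] : Prop :=
  ∃ (X : Scheme.{u}) (f : X ⟶ Spec (CommRingCat.of Fq)) (pt : X) (hpt : IsClosed ({pt} : Set X)),
    SmoothOfRelativeDimension 1 f ∧ IsProper f ∧ GeometricallyIrreducible f ∧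
    ∃ e : A ≃+* X.presheaf.obj (Opposite.op (⟨{pt}ᶜ, hpt.isOpen_compl⟩ : X.Opens)),
      ∀ c : Fq, e (algebraMap Fq A c) =
        ((Scheme.ΓSpecIso (CommRingCat.of Fq)).inv ≫ f.appTop ≫
          X.presheaf.map (homOfLE (le_top : (⟨{pt}ᶜ, hpt.isOpen_compl⟩ : X.Opens) ≤ ⊤)).op).hom c

/-! ### Twisted polynomials -/

/-- The action of `ℕ` on `R` through powers of the `q`-Frobenius. -/
@[reducible] def frobAction (Fq : Type*) [Field Fq] [Fintype Fq] (R : Type*) [CommRing R]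
    [Algebra Fq R] : MulSemiringAction (Multiplicative ℕ) R :=
  MulSemiringAction.compHom R (powersHom (R →+* R) (qFrob Fq R))

theorem frobAction_smul (Fq : Type*) [Field Fq] [Fintype Fq] (R : Type*) [CommRing R]
    [Algebra Fq R] (n : ℕ) (x : R) :
    letI := frobAction Fq R
    Multiplicative.ofAdd n • x = x ^ (Fintype.card Fq ^ n) := by
  change ((qFrob Fq R) ^ n) x = _
  induction n generalizing x with
  | zero => simp
  | succ n ih =>
    rw [pow_succ, RingHom.mul_def, RingHom.comp_apply, ih, qFrob_apply, ← pow_mul, pow_succ']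

/-- The twisted polynomial ring `R[τ]`, with `τ * x = x ^ q * τ`. -/
def TwistedPoly (Fq : Type*) [Field Fq] [Fintype Fq] (R : Type*) [CommRing R] [Algebra Fq R] :
    Type _ :=
  SkewPolynomial R

namespace TwistedPoly

variable (Fq : Type*) [Field Fq] [Fintype Fq] (R : Type*) [CommRing R] [Algebra Fq R]

instance : Ring (TwistedPoly Fq R) :=
  @SkewMonoidAlgebra.instRing R (Multiplicative ℕ) _ _ (frobAction Fq R)

/-- Left multiplication by scalars. -/
instance : Module R (TwistedPoly Fq R) :=
  inferInstanceAs (Module R (SkewMonoidAlgebra R (Multiplicative ℕ)))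

variable {R}

/-- The twisted polynomial `x τ ^ i`. -/
def monomial (i : ℕ) (x : R) : TwistedPoly Fq R := SkewPolynomial.monomial i x

variable {Fq}

/-- The coefficient of `τ ^ i`. -/
def coeff (f : TwistedPoly Fq R) (i : ℕ) : R := SkewPolynomial.coeff f i

variable (Fq)

theorem monomial_add (i : ℕ) (x y : R) :
    monomial Fq i (x + y) = monomial Fq i x + monomial Fq i y :=
  SkewMonoidAlgebra.single_add _ x y

theorem monomial_mul_monomial (i j : ℕ) (x y : R) :
    monomial Fq i x * monomial Fq j y = monomial Fq (i + j) (x * y ^ (Fintype.card Fq ^ i)) := by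
  rw [← frobAction_smul]
  let := frobAction Fq R
  exact SkewMonoidAlgebra.single_mul_single
    (k := R) (a₁ := Multiplicative.ofAdd i) (a₂ := Multiplicative.ofAdd j) (b₁ := x) (b₂ := y)

theorem induction {motive : TwistedPoly Fq R → Prop} (f : TwistedPoly Fq R) (zero : motive 0)
    (add : ∀ (n : ℕ) (r : R) (g : TwistedPoly Fq R), motive g → motive (monomial Fq n r + g)) :
    motive f :=
  SkewPolynomial.induction f zero (fun n r g _ _ hg => add n r g hg)

theorem smul_monomial (x : R) (n : ℕ) (r : R) :
    x • monomial Fq n r = monomial Fq n (x * r) :=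
  SkewPolynomial.smul_monomial n x r

theorem smul_eq (x : R) (f : TwistedPoly Fq R) : x • f = monomial Fq 0 x * f := by
  induction f using induction with
  | zero => rw [smul_zero, mul_zero]
  | add n r g hg =>
    rw [smul_add, mul_add, hg, smul_monomial, monomial_mul_monomial]
    simp

theorem one_def : (1 : TwistedPoly Fq R) = monomial Fq 0 1 := rfl

variable (R)

/-- The constants `Fq → R[τ]`, which are central. -/
def ofFq : Fq →+* TwistedPoly Fq R where
  toFun c := monomial Fq 0 (algebraMap Fq R c)
  map_one' := by rw [map_one, one_def]
  map_mul' c c' := by rw [monomial_mul_monomial, map_mul]; simp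
  map_zero' := by rw [map_zero]; exact SkewMonoidAlgebra.single_zero _
  map_add' c c' := by rw [map_add, monomial_add]

instance : Algebra Fq (TwistedPoly Fq R) :=
  (ofFq Fq R).toAlgebra' fun c f => by
    induction f using induction with
    | zero => rw [mul_zero, zero_mul]
    | add n r g hg =>
      rw [mul_add, add_mul, hg]
      congr 1
      change monomial Fq 0 (algebraMap Fq R c) * monomial Fq n r
        = monomial Fq n r * monomial Fq 0 (algebraMap Fq R c)
      rw [monomial_mul_monomial, monomial_mul_monomial, ← map_pow, FiniteField.pow_card_pow,
        mul_comm]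
      simp

variable {R}

theorem algebraMap_eq (c : Fq) :
    algebraMap Fq (TwistedPoly Fq R) c = monomial Fq 0 (algebraMap Fq R c) := rfl

instance : IsScalarTower R (TwistedPoly Fq R) (TwistedPoly Fq R) :=
  ⟨fun x f g => by rw [smul_eq, smul_eq, smul_eq_mul, smul_eq_mul, mul_assoc]⟩

instance : IsScalarTower Fq R (TwistedPoly Fq R) :=
  ⟨fun c x f => by
    rw [Algebra.smul_def, Algebra.smul_def, smul_eq, smul_eq, algebraMap_eq, ← mul_assoc,
      monomial_mul_monomial]
    simp⟩

variable (R)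

/-- The variable `τ`. -/
def tau : TwistedPoly Fq R := monomial Fq 1 1

variable {R}

theorem tau_mul_smul (x : R) (f : TwistedPoly Fq R) :
    tau Fq R * (x • f) = (x ^ Fintype.card Fq) • (tau Fq R * f) := by
  rw [smul_eq, smul_eq, ← mul_assoc, ← mul_assoc, tau, monomial_mul_monomial,
    monomial_mul_monomial]
  simp

end TwistedPoly

/-! ### Modules with a semilinear `τ` over `A_R`, and `A`-motives -/

/-- An `A_R`-module `M` with an additive `τ : M → M` such that `τ (b m) = b⁽¹⁾ τ m`; this is the
same as an `A_R`-linear map `τ_M : τ^* M → M`. -/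
structure TauModule (Fq : Type*) [Field Fq] [Fintype Fq] (A : Type*) [CommRing A] [Algebra Fq A]
    (R : Type*) [CommRing R] [Algebra Fq R] where
  carrier : Type w
  [addCommGroup : AddCommGroup carrier]
  [module : Module (R ⊗[Fq] A) carrier]
  τ : carrier →ₛₗ[twist Fq A R] carrier

attribute [instance] TauModule.addCommGroup TauModule.module

/-- The ring `A_R`, seen as an `A_R`-algebra through the twist. -/
def TwistedBase (Fq : Type*) [Field Fq] [Fintype Fq] (A : Type*) [CommRing A] [Algebra Fq A]
    (R : Type*) [CommRing R] [Algebra Fq R] : Type _ := R ⊗[Fq] A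

namespace TwistedBase

variable (Fq : Type*) [Field Fq] [Fintype Fq] (A : Type*) [CommRing A] [Algebra Fq A]
  (R : Type*) [CommRing R] [Algebra Fq R]

instance : CommRing (TwistedBase Fq A R) := inferInstanceAs (CommRing (R ⊗[Fq] A))

/-- The identity map, from `A_R` to its twisted copy and back. -/
def equiv : (R ⊗[Fq] A) ≃+* TwistedBase Fq A R := RingEquiv.refl _

instance : Algebra (R ⊗[Fq] A) (TwistedBase Fq A R) :=
  ((equiv Fq A R : (R ⊗[Fq] A) →+* TwistedBase Fq A R).comp (twist Fq A R)).toAlgebra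

theorem algebraMap_apply (x : R ⊗[Fq] A) :
    algebraMap (R ⊗[Fq] A) (TwistedBase Fq A R) x = equiv Fq A R (twist Fq A R x) := rfl

end TwistedBase

namespace TauModule

variable {Fq : Type*} [Field Fq] [Fintype Fq] {A : Type*} [CommRing A] [Algebra Fq A]
  {R : Type*} [CommRing R] [Algebra Fq R]

/-- The pull-back `τ^* M = A_R ⊗_{τ, A_R} M`. It is a module over (the twisted copy of) `A_R` by
multiplication on the left factor. -/
abbrev pullback (M : TauModule.{w} Fq A R) : Type _ :=
  TwistedBase Fq A R ⊗[R ⊗[Fq] A] M.carrier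

/-- The linear map `τ_M : τ^* M → M`, `b ⊗ m ↦ b • τ m`. -/
def lin (M : TauModule.{w} Fq A R) : M.pullback →+ M.carrier :=
  TensorProduct.liftAddHom
    { toFun := fun b =>
        { toFun := fun m => (TwistedBase.equiv Fq A R).symm b • M.τ m
          map_zero' := by simp
          map_add' := fun m m' => by simp }
      map_zero' := by ext m; simp
      map_add' := fun b b' => by ext m; simp [add_smul] }
    (fun r b m => by
      change (TwistedBase.equiv Fq A R).symm (r • b) • M.τ m
        = (TwistedBase.equiv Fq A R).symm b • M.τ (r • m)
      rw [M.τ.map_smulₛₗ, smul_smul, Algebra.smul_def, TwistedBase.algebraMap_apply, map_mul,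
        RingEquiv.symm_apply_apply, mul_comm])

theorem lin_tmul (M : TauModule.{w} Fq A R) (b : R ⊗[Fq] A) (m : M.carrier) :
    M.lin (TwistedBase.equiv Fq A R b ⊗ₜ m) = b • M.τ m := rfl

/-- `M` is finite projective of constant rank `r` over `A_R`. -/
def HasRank (M : TauModule.{w} Fq A R) (r : ℕ) : Prop :=
  Module.Finite (R ⊗[Fq] A) M.carrier ∧ Module.Projective (R ⊗[Fq] A) M.carrier ∧
    ∀ p : PrimeSpectrum (R ⊗[Fq] A), Module.rankAtStalk (R := R ⊗[Fq] A) M.carrier p = r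

/-- `M` is an effective abelian `A`-motive of rank `r`: it is finite projective of rank `r` and
`τ_M : τ^* M → M` becomes an isomorphism after inverting `𝔧`, that is, every element of its kernel
and of its cokernel is annihilated by a power of `𝔧`. -/
def IsMotive [Algebra A R] (M : TauModule.{w} Fq A R) (r : ℕ) : Prop :=
  M.HasRank r ∧
    (∀ x : M.pullback, M.lin x = 0 →
      ∃ k : ℕ, ∀ y ∈ idealJ Fq A R ^ k, TwistedBase.equiv Fq A R y • x = 0) ∧
    (∀ m : M.carrier, ∃ k : ℕ, ∀ y ∈ idealJ Fq A R ^ k, y • m ∈ M.lin.range)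

/-- `M ≅ N`: there is an `A_R`-linear bijection that commutes with `τ`. -/
def IsIso {Fq : Type*} [Field Fq] [Fintype Fq] {A : Type*} [CommRing A] [Algebra Fq A]
    {R : Type*} [CommRing R] [Algebra Fq R]
    (M : TauModule.{v} Fq A R) (N : TauModule.{w} Fq A R) : Prop :=
  ∃ e : M.carrier ≃ₗ[R ⊗[Fq] A] N.carrier, ∀ m : M.carrier, e (M.τ m) = N.τ (e m)

/-- The tensor product over `A_R`, with `τ (m ⊗ n) = τ m ⊗ τ n`. -/
def tensor (M : TauModule.{v} Fq A R) (N : TauModule.{w} Fq A R) : TauModule Fq A R where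
  carrier := M.carrier ⊗[R ⊗[Fq] A] N.carrier
  τ := TensorProduct.map M.τ N.τ

end TauModule

/-! ### Anderson modules and their motives -/

/-- An Anderson `A`-module of dimension `N` over `R` with underlying group scheme `𝔾_a ^ N`: an
`Fq`-algebra homomorphism `φ : A → Mat_N(R[τ])` such that `(∂φ_a - ι(a)) ^ N = 0` for all `a`,
where `∂` is the constant coefficient and `ι : A → R` the structure map. -/
structure AndersonModule (Fq : Type*) [Field Fq] [Fintype Fq] (A : Type*) [CommRing A]
    [Algebra Fq A] (R : Type*) [CommRing R] [Algebra Fq R] [Algebra A R] (N : ℕ) where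
  φ : A →ₐ[Fq] Matrix (Fin N) (Fin N) (TwistedPoly Fq R)
  nilpotent : ∀ a : A,
    ((φ a).map (fun f => f.coeff 0) - Matrix.scalar (Fin N) (algebraMap A R a)) ^ N = 0

namespace AndersonModule

variable {Fq : Type*} [Field Fq] [Fintype Fq] {A : Type*} [CommRing A] [Algebra Fq A]
  {R : Type*} [CommRing R] [Algebra Fq R] [Algebra A R] {N : ℕ}

/-- The row vectors over `R[τ]`, that is, the `Fq`-linear homomorphisms `𝔾_a ^ N → 𝔾_a`. -/
def Hom (_ : AndersonModule Fq A R N) : Type _ := Fin N → TwistedPoly Fq R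

variable (ℰ : AndersonModule Fq A R N)

instance : AddCommGroup ℰ.Hom := inferInstanceAs (AddCommGroup (Fin N → TwistedPoly Fq R))

instance : Module R ℰ.Hom := inferInstanceAs (Module R (Fin N → TwistedPoly Fq R))

instance : Module Fq ℰ.Hom := inferInstanceAs (Module Fq (Fin N → TwistedPoly Fq R))

instance : IsScalarTower Fq R ℰ.Hom :=
  inferInstanceAs (IsScalarTower Fq R (Fin N → TwistedPoly Fq R))

/-- `a` acts by `m ↦ m ∘ φ_a`. -/
instance : Module A ℰ.Hom where
  smul a m := Matrix.vecMul (α := TwistedPoly Fq R) m (ℰ.φ a)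
  one_smul m := by
    change Matrix.vecMul (α := TwistedPoly Fq R) m (ℰ.φ 1) = m
    rw [map_one]
    exact Matrix.vecMul_one _
  mul_smul a b m := by
    change Matrix.vecMul (α := TwistedPoly Fq R) m (ℰ.φ (a * b)) =
      Matrix.vecMul (α := TwistedPoly Fq R) (Matrix.vecMul (α := TwistedPoly Fq R) m (ℰ.φ b))
        (ℰ.φ a)
    rw [mul_comm, map_mul]
    exact (Matrix.vecMul_vecMul _ _ _).symm
  smul_zero a := Matrix.zero_vecMul _
  smul_add a m m' := Matrix.add_vecMul _ _ _
  add_smul a b m := by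
    change Matrix.vecMul (α := TwistedPoly Fq R) m (ℰ.φ (a + b)) = _
    rw [map_add]
    exact Matrix.vecMul_add _ _ _
  zero_smul m := by
    change Matrix.vecMul (α := TwistedPoly Fq R) m (ℰ.φ 0) = 0
    rw [map_zero]
    exact Matrix.vecMul_zero _

theorem smul_def (a : A) (m : ℰ.Hom) :
    a • m = (Matrix.vecMul (α := TwistedPoly Fq R) m (ℰ.φ a) : Fin N → TwistedPoly Fq R) := rfl

instance : SMulCommClass R A ℰ.Hom :=
  ⟨fun x a m => (Matrix.smul_vecMul (α := TwistedPoly Fq R) x m (ℰ.φ a)).symm⟩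

instance : IsScalarTower Fq A ℰ.Hom := ⟨fun c a m => by
  rw [smul_def, smul_def, map_smul]
  exact Matrix.vecMul_smul (α := TwistedPoly Fq R) m c (ℰ.φ a)⟩

/-- The action `(x ⊗ a) • m = x • (m ∘ φ_a)` of `A_R`. -/
instance : Module (R ⊗[Fq] A) ℰ.Hom := TensorProduct.Algebra.module

theorem tmul_smul (x : R) (a : A) (m : ℰ.Hom) : (x ⊗ₜ[Fq] a) • m = x • a • m :=
  TensorProduct.Algebra.smul_def x a m

variable {ℰ} in
/-- Composition with the Frobenius of `𝔾_a`: `m ↦ τ * m`. -/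
def frob (m : ℰ.Hom) : ℰ.Hom := fun i => TwistedPoly.tau Fq R * m i

theorem frob_add (m m' : ℰ.Hom) : frob (m + m') = frob m + frob m' :=
  funext fun i => mul_add _ (m i) (m' i)

theorem frob_zero : frob (0 : ℰ.Hom) = 0 := funext fun _ => mul_zero _

theorem frob_smul (x : R) (m : ℰ.Hom) : frob (x • m) = (x ^ Fintype.card Fq) • frob m :=
  funext fun i => TwistedPoly.tau_mul_smul Fq x (m i)

theorem frob_act (a : A) (m : ℰ.Hom) : frob (a • m) = a • frob m :=
  funext fun i => by
    change TwistedPoly.tau Fq R * (∑ j, m j * ℰ.φ a j i)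
      = ∑ j, (TwistedPoly.tau Fq R * m j) * ℰ.φ a j i
    refine (Finset.mul_sum _ _ _).trans (Finset.sum_congr rfl fun j _ => ?_)
    exact (mul_assoc _ _ _).symm

/-- The motive of an Anderson module: `Hom_{Fq}(ℰ, 𝔾_a)` with `τ m = Frob_q ∘ m`. -/
def motive : TauModule Fq A R where
  carrier := ℰ.Hom
  τ :=
    { toFun := ℰ.frob
      map_add' := ℰ.frob_add
      map_smul' := fun b m => by
        induction b using TensorProduct.induction_on with
        | zero => rw [map_zero, zero_smul, zero_smul, frob_zero]
        | add b b' hb hb' => rw [map_add, add_smul, add_smul, frob_add, hb, hb']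
        | tmul x a => rw [twist_tmul, tmul_smul, tmul_smul, frob_smul, frob_act] }

/-- `ℰ` is abelian of rank `r`. -/
def IsAbelianOfRank (r : ℕ) : Prop := ℰ.motive.HasRank r

end AndersonModule

/-! ### Artin representations and their motives -/

/-- A representation of `Gal(Es/E)` is an Artin representation if it factors through the Galois
group of a finite Galois extension of `E`. -/
def IsArtin {E : Type*} [Field E] {Es : Type*} [Field Es] [Algebra E Es]
    {H : Type*} [Monoid H] (ρ : (Es ≃ₐ[E] Es) →* H) : Prop :=
  ∃ L : IntermediateField E Es, FiniteDimensional E L ∧ IsGalois E L ∧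
    ∀ g ∈ L.fixingSubgroup, ρ g = 1

/-- A representation over `k`, seen as a representation over `Fq`. -/
def resRep (Fq : Type*) [Field Fq] {k : Type*} [Field k] [Algebra Fq k] {G : Type*} [Group G]
    {W : Type*} [AddCommGroup W] [Module k W] [Module Fq W] [IsScalarTower Fq k W]
    (ρ : Representation k G W) : Representation Fq G W where
  toFun g := (ρ g).restrictScalars Fq
  map_one' := by rw [map_one]; rfl
  map_mul' g h := by rw [map_mul]; rfl

section ArtinMotive

variable {Fq : Type*} [Field Fq] [Fintype Fq]
  {E : Type*} [Field E] [Algebra Fq E]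
  {Es : Type*} [Field Es] [Algebra Fq Es] [Algebra E Es] [IsScalarTower Fq E Es]
  {V : Type*} [AddCommGroup V] [Module Fq V]

/-- The diagonal action `g (x ⊗ v) = g x ⊗ g v` on `Es ⊗ V`. -/
def diagAct (ρ : Representation Fq (Es ≃ₐ[E] Es) V) (g : Es ≃ₐ[E] Es) :
    (Es ⊗[Fq] V) →ₗ[E] (Es ⊗[Fq] V) :=
  TensorProduct.AlgebraTensorModule.map g.toLinearMap (ρ g)

theorem diagAct_tmul (ρ : Representation Fq (Es ≃ₐ[E] Es) V) (g : Es ≃ₐ[E] Es) (x : Es) (v : V) :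
    diagAct ρ g (x ⊗ₜ v) = g x ⊗ₜ ρ g v := rfl

/-- `D(V) = (Es ⊗ V) ^ G`, an `E`-vector space. -/
def repD (ρ : Representation Fq (Es ≃ₐ[E] Es) V) : Submodule E (Es ⊗[Fq] V) where
  carrier := {x | ∀ g, diagAct ρ g x = x}
  add_mem' hx hy g := by rw [map_add, hx g, hy g]
  zero_mem' g := map_zero _
  smul_mem' c x hx g := by rw [map_smul, hx g]

variable (Fq Es V) in
/-- The Frobenius `x ⊗ v ↦ x ^ q ⊗ v` on `Es ⊗ V`. -/
def tensorFrob : (Es ⊗[Fq] V) →ₗ[Fq] (Es ⊗[Fq] V) :=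
  LinearMap.rTensor V (FiniteField.frobeniusAlgHom Fq Es).toLinearMap

theorem tensorFrob_tmul (x : Es) (v : V) :
    tensorFrob Fq Es V (x ⊗ₜ v) = (x ^ Fintype.card Fq) ⊗ₜ v := rfl

theorem tensorFrob_smul (c : E) (x : Es ⊗[Fq] V) :
    tensorFrob Fq Es V (c • x) = (c ^ Fintype.card Fq) • tensorFrob Fq Es V x := by
  induction x using TensorProduct.induction_on with
  | zero => simp
  | add x y hx hy => rw [smul_add, map_add, hx, hy, map_add, smul_add]
  | tmul x v =>
    rw [TensorProduct.smul_tmul', tensorFrob_tmul, tensorFrob_tmul, TensorProduct.smul_tmul',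
      smul_pow]

theorem tensorFrob_diagAct (ρ : Representation Fq (Es ≃ₐ[E] Es) V) (g : Es ≃ₐ[E] Es)
    (x : Es ⊗[Fq] V) :
    diagAct ρ g (tensorFrob Fq Es V x) = tensorFrob Fq Es V (diagAct ρ g x) := by
  induction x using TensorProduct.induction_on with
  | zero => simp
  | add x y hx hy => simp only [map_add, hx, hy]
  | tmul x v => rw [tensorFrob_tmul, diagAct_tmul, diagAct_tmul, tensorFrob_tmul, map_pow]

/-- The semilinear Frobenius of `D(V)`. -/
def repDFrob (ρ : Representation Fq (Es ≃ₐ[E] Es) V) : repD ρ →ₛₗ[qFrob Fq E] repD ρ where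
  toFun x := ⟨tensorFrob Fq Es V x, fun g => by rw [tensorFrob_diagAct, x.2 g]⟩
  map_add' x y := Subtype.ext (map_add _ _ _)
  map_smul' c x := Subtype.ext (tensorFrob_smul c _)

variable (A : Type*) [CommRing A] [Algebra Fq A]

variable (Fq E) in
/-- The twist of `A_E` as a semilinear map of `E`-vector spaces. -/
def twistSemilinear : (E ⊗[Fq] A) →ₛₗ[qFrob Fq E] (E ⊗[Fq] A) where
  toFun := twist Fq A E
  map_add' := map_add _
  map_smul' c x := by
    rw [Algebra.smul_def, map_mul, Algebra.smul_def]
    rfl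

/-- The motive `A_E ⊗_E D(V)` with `τ (b ⊗ x) = b⁽¹⁾ ⊗ τ x`. -/
def artinMotive (ρ : Representation Fq (Es ≃ₐ[E] Es) V) : TauModule Fq A E where
  carrier := (E ⊗[Fq] A) ⊗[E] (repD ρ)
  τ :=
    { toFun := TensorProduct.map (twistSemilinear Fq E A) (repDFrob ρ)
      map_add' := map_add _
      map_smul' := fun b x => by
        induction x using TensorProduct.induction_on with
        | zero => simp
        | add x y hx hy => rw [smul_add, map_add, hx, hy, map_add, smul_add]
        | tmul x v =>
          rw [TensorProduct.smul_tmul', TensorProduct.map_tmul, TensorProduct.map_tmul,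
            TensorProduct.smul_tmul']
          exact congrArg (· ⊗ₜ[E] repDFrob ρ v) (map_mul (twist Fq A E) b x) }

end ArtinMotive

/-- The twisted motive `M(φ, V) = M(φ) ⊗ M(V)`. -/
def twistedMotive {Fq : Type*} [Field Fq] [Fintype Fq] {A : Type*} [CommRing A] [Algebra Fq A]
    {E : Type*} [Field E] [Algebra Fq E] [Algebra A E]
    {Es : Type*} [Field Es] [Algebra Fq Es] [Algebra E Es] [IsScalarTower Fq E Es]
    {V : Type*} [AddCommGroup V] [Module Fq V]
    (φ : AndersonModule Fq A E 1) (ρ : Representation Fq (Es ≃ₐ[E] Es) V) : TauModule Fq A E :=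
  φ.motive.tensor (artinMotive A ρ)

/-! ### Representations with values in `GL_n` of an algebraic closure of `Fq` -/

section Matrices

variable (Fq : Type*) [Field Fq] {F : Type*} [Field F] [Algebra Fq F] {G : Type*} [Group G] {n : ℕ}

/-- `Fq(ρ)`, the field generated over `Fq` by the entries of the matrices `ρ(g)`. -/
def coeffField (ρ : G →* GL (Fin n) F) : IntermediateField Fq F :=
  IntermediateField.adjoin Fq {x | ∃ g i j, x = (ρ g : Matrix (Fin n) (Fin n) F) i j}

/-- The matrices `ρ(g)`, with entries in `Fq(ρ)`. -/
def coeffMatrix (ρ : G →* GL (Fin n) F) : G →* Matrix (Fin n) (Fin n) (coeffField Fq ρ) where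
  toFun g := Matrix.of fun i j => ⟨(ρ g : Matrix (Fin n) (Fin n) F) i j,
    IntermediateField.subset_adjoin Fq _ ⟨g, i, j, rfl⟩⟩
  map_one' := by
    ext i j
    by_cases h : i = j <;> simp [Matrix.one_apply, h]
  map_mul' g h := by
    ext i j
    simp [Matrix.mul_apply]

/-- The representation `V_ρ = Fq(ρ) ^ n`, with `g (v_j) = ∑ i, ρ(g)_{ij} v_i`. -/
def coeffRep (ρ : G →* GL (Fin n) F) :
    Representation (coeffField Fq ρ) G (Fin n → coeffField Fq ρ) :=
  ((Matrix.toLinAlgEquiv' :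
    Matrix (Fin n) (Fin n) (coeffField Fq ρ) ≃ₐ[coeffField Fq ρ] _) : _ →* _).comp
    (coeffMatrix Fq ρ)

theorem coeffRep_apply (ρ : G →* GL (Fin n) F) (g : G) (v : Fin n → coeffField Fq ρ) :
    coeffRep Fq ρ g v = Matrix.mulVec (coeffMatrix Fq ρ g) v := rfl

end Matrices

end

noncomputable section

/-! ### Maps out of the twisted polynomial ring -/

namespace TwistedPoly

section

variable {Fq : Type*} [Field Fq] [Fintype Fq] {R : Type*} [CommRing R] [Algebra Fq R]

/-! Identify M(φ) with E[τ], where a acts by right multiplication by φ_a. By Galois descent D(V) has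
an E-basis b_1, …, b_N with N = dim V over F_q, and the Frobenius carries it to another basis: τ b_j
= ∑_l B_jl b_l with B in GL_N(E) (`exists_basis_repD`). Hence M(V) is free over A_E, with τ given by
the same matrix B (`exists_basis_artinMotive`).

Put C = B⁻¹. Scalar matrices commute with C, so x ↦ xI, τ ↦ Cτ defines a ring homomorphism Ψ : E[τ]
→ Mat_N(E[τ]) (`matrixHom`), and ℰ_a = Ψ(φ_a) is the Anderson module sought (`matrixTwist`). The
isomorphism sends m ⊗ b_j to row j of Ψ(m). It is A-linear because Ψ is multiplicative. It commutes
with τ because B Ψ(τm) = B Cτ Ψ(m) = τ Ψ(m) (`sum_smul_rowHom_τ`). It is bijective because (Cτ)^i =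
C_i τ^i with C_i invertible, so that on coefficients of τ^i it is multiplication by C_i
(`rowsHom_bijective`).

The constant term of Ψ(φ_a) is ι(a)I. For such a module the linearization of τ is injective, its
image contains all vectors without constant term, and 𝔧 moves every vector into that image
(`isMotive`). The rank rN is read off the tensor product, and both facts travel along the
isomorphism. Part (2) is the case k = F_q(ρ), which is finite over F_q because ρ has finite image.
-/

variable (Fq) in
theorem monomial_zero_right (i : ℕ) : monomial Fq i (0 : R) = 0 :=
  SkewMonoidAlgebra.single_zero _

theorem coeff_monomial (i j : ℕ) (x : R) :
    coeff (monomial Fq i x) j = if i = j then x else 0 :=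
  SkewPolynomial.coeff_monomial

theorem coeff_add (f g : TwistedPoly Fq R) (i : ℕ) :
    coeff (f + g) i = coeff f i + coeff g i :=
  SkewPolynomial.coeff_add f g i

theorem coeff_zero (i : ℕ) : coeff (0 : TwistedPoly Fq R) i = 0 := rfl

theorem ext {f g : TwistedPoly Fq R} (h : ∀ i, coeff f i = coeff g i) : f = g :=
  SkewPolynomial.ext h

variable (Fq) in
/-- `monomial` as an additive map. -/
def monomialHom (i : ℕ) : R →+ TwistedPoly Fq R where
  toFun := monomial Fq i
  map_zero' := monomial_zero_right Fq i
  map_add' := monomial_add Fq i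

/-- `coeff` as an additive map. -/
def coeffHom (i : ℕ) : TwistedPoly Fq R →+ R where
  toFun f := coeff f i
  map_zero' := coeff_zero i
  map_add' f g := coeff_add f g i

/-- The additive map which is `c i` on the monomials of degree `i`. -/
def sumHom {S : Type*} [AddCommMonoid S] (c : ℕ → R →+ S) : TwistedPoly Fq R →+ S where
  toFun f := SkewPolynomial.sum f fun i x => c i x
  map_zero' := SkewPolynomial.sum_zero_index _
  map_add' f g := SkewPolynomial.sum_add_index f g _ (fun i => map_zero (c i))
    (fun i x y => map_add (c i) x y)

theorem sumHom_monomial {S : Type*} [AddCommMonoid S] (c : ℕ → R →+ S) (i : ℕ) (x : R) :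
    sumHom c (monomial Fq i x) = c i x :=
  SkewPolynomial.sum_monomial_index (n := i) (b := x) (h := fun i x => c i x) (map_zero (c i))

omit [Field Fq] [Algebra Fq R] in
theorem pow_mul_comm {S : Type*} [Semiring S] (f : R →+* S) (t : S)
    (h : ∀ x, t * f x = f (x ^ Fintype.card Fq) * t) (i : ℕ) (x : R) :
    t ^ i * f x = f (x ^ Fintype.card Fq ^ i) * t ^ i := by
  induction i with
  | zero => simp
  | succ i ih => rw [pow_succ', mul_assoc, ih, ← mul_assoc, h, ← pow_mul, ← pow_succ, mul_assoc]

/-- The ring homomorphism `∑ x_i τ ^ i ↦ ∑ f(x_i) t ^ i`, where `t f(x) = f(x ^ q) t`. -/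
def lift {S : Type*} [Semiring S] (f : R →+* S) (t : S)
    (h : ∀ x, t * f x = f (x ^ Fintype.card Fq) * t) : TwistedPoly Fq R →+* S :=
  { sumHom fun i => (AddMonoidHom.mulRight (t ^ i)).comp (f : R →+ S) with
    map_one' := by
      change sumHom _ (1 : TwistedPoly Fq R) = 1
      rw [one_def, sumHom_monomial]
      simp
    map_mul' := fun a b => by
      change sumHom _ (a * b) = sumHom _ a * sumHom _ b
      have hmul : ∀ n r, sumHom (fun i => (AddMonoidHom.mulRight (t ^ i)).comp (f : R →+ S))
          (monomial Fq n r * b) = f r * t ^ n *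
            sumHom (fun i => (AddMonoidHom.mulRight (t ^ i)).comp (f : R →+ S)) b :=
        fun n r => by
        induction b using induction with
        | zero => rw [mul_zero, map_zero, mul_zero]
        | add m s b hb =>
          rw [mul_add, map_add, map_add, mul_add, hb, monomial_mul_monomial, sumHom_monomial,
            sumHom_monomial]
          change f (r * s ^ Fintype.card Fq ^ n) * t ^ (n + m) + _ =
            f r * t ^ n * (f s * t ^ m) + _
          congr 1
          rw [map_mul, pow_add, mul_assoc (f r) (t ^ n), ← mul_assoc (t ^ n) (f s),
            pow_mul_comm f t h]
          simp only [mul_assoc]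
      induction a using induction with
      | zero => rw [zero_mul, map_zero, zero_mul]
      | add n r a ha =>
        rw [add_mul, map_add, map_add, add_mul, ha, hmul, sumHom_monomial]
        rfl }

theorem lift_monomial {S : Type*} [Semiring S] (f : R →+* S) (t : S)
    (h : ∀ x, t * f x = f (x ^ Fintype.card Fq) * t) (i : ℕ) (x : R) :
    lift f t h (monomial Fq i x) = f x * t ^ i :=
  sumHom_monomial (fun i => (AddMonoidHom.mulRight (t ^ i)).comp (f : R →+ S)) i x

/-- The constant coefficient as a ring homomorphism. -/
def constCoeff : TwistedPoly Fq R →+* R :=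
  -- Sending τ to 0 satisfies the commutation rule trivially; as 0 ^ 0 = 1, exactly the term of
  -- degree 0 survives.
  lift (Fq := Fq) (RingHom.id R) 0 fun x => by rw [zero_mul, mul_zero]

theorem constCoeff_apply (f : TwistedPoly Fq R) : constCoeff f = coeff f 0 := by
  induction f using induction with
  | zero => rw [map_zero, coeff_zero]
  | add n r g hg =>
    rw [map_add, hg, coeff_add, constCoeff, lift_monomial, coeff_monomial]
    cases n <;> simp

theorem tau_mul_monomial (i : ℕ) (x : R) :
    tau Fq R * monomial Fq i x = monomial Fq (i + 1) (x ^ Fintype.card Fq) := by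
  rw [tau, monomial_mul_monomial, one_mul, pow_one, add_comm]

end

end TwistedPoly

/-! ### Anderson modules on which `∂` acts by scalars -/

namespace TauModule

variable {Fq : Type*} [Field Fq] [Fintype Fq] {A : Type*} [CommRing A] [Algebra Fq A]
  {R : Type*} [CommRing R] [Algebra Fq R]

theorem lin_smul (M : TauModule.{w} Fq A R) (b : R ⊗[Fq] A) (x : M.pullback) :
    M.lin (TwistedBase.equiv Fq A R b • x) = b • M.lin x := by
  induction x using TensorProduct.induction_on with
  | zero => simp
  | add x y hx hy => rw [smul_add, map_add, hx, hy, map_add, smul_add]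
  | tmul c m =>
    obtain ⟨c, rfl⟩ := (TwistedBase.equiv Fq A R).surjective c
    rw [TensorProduct.smul_tmul', smul_eq_mul, ← map_mul, lin_tmul, lin_tmul, mul_smul]

theorem IsIso.symm {M : TauModule.{v} Fq A R} {N : TauModule.{w} Fq A R} (h : M.IsIso N) :
    N.IsIso M := by
  obtain ⟨e, he⟩ := h
  exact ⟨e.symm, fun n => by rw [LinearEquiv.symm_apply_eq, he, e.apply_symm_apply]⟩

theorem HasRank.of_isIso {M : TauModule.{v} Fq A R} {N : TauModule.{w} Fq A R} {r : ℕ}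
    (h : M.IsIso N) (hN : N.HasRank r) : M.HasRank r := by
  obtain ⟨e, -⟩ := h
  obtain ⟨h₁, h₂, h₃⟩ := hN
  exact ⟨Module.Finite.equiv e.symm, Module.Projective.of_equiv e.symm, fun p => by
    rw [Module.rankAtStalk_eq_of_equiv e, h₃ p]⟩

theorem IsMotive.of_isIso [Algebra A R] {M : TauModule.{v} Fq A R} {N : TauModule.{w} Fq A R}
    {r : ℕ} (h : M.IsIso N) (hN : N.IsMotive r) : M.IsMotive r := by
  refine ⟨hN.1.of_isIso h, ?_⟩
  obtain ⟨-, hker, hcoker⟩ := hN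
  obtain ⟨e, he⟩ := h
  -- This is τ^*e; it intertwines the two linearizations, so kernels and cokernels correspond.
  let e' : M.pullback ≃ₗ[TwistedBase Fq A R] N.pullback :=
    e.baseChange (R ⊗[Fq] A) (TwistedBase Fq A R) M.carrier N.carrier
  have hlin : ∀ x : M.pullback, N.lin (e' x) = e (M.lin x) := fun x => by
    induction x using TensorProduct.induction_on with
    | zero => simp
    | add x y hx hy => rw [map_add, map_add, hx, hy, map_add, map_add]
    | tmul c m =>
      obtain ⟨c, rfl⟩ := (TwistedBase.equiv Fq A R).surjective c
      have : e' (TwistedBase.equiv Fq A R c ⊗ₜ m) = TwistedBase.equiv Fq A R c ⊗ₜ e m := rfl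
      rw [this, lin_tmul, lin_tmul, map_smul, he]
  refine ⟨fun x hx => ?_, fun m => ?_⟩
  · obtain ⟨k, hk⟩ := hker (e' x) (by rw [hlin, hx, map_zero])
    refine ⟨k, fun y hy => e'.injective ?_⟩
    rw [map_smul, hk y hy, map_zero]
  · obtain ⟨k, hk⟩ := hcoker (e m)
    refine ⟨k, fun y hy => ?_⟩
    obtain ⟨z, hz⟩ := hk y hy
    refine ⟨e'.symm z, e.injective ?_⟩
    rw [← hlin, e'.apply_symm_apply, hz, map_smul]

end TauModule

/-! ### Kernel and cokernel of the linearized τ on the motive of an Anderson module. -/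

namespace AndersonModule

variable {Fq : Type*} [Field Fq] [Fintype Fq] {A : Type*} [CommRing A] [Algebra Fq A]
  {R : Type*} [CommRing R] [Algebra Fq R] [Algebra A R] {N : ℕ} (ℰ : AndersonModule Fq A R N)

/-- The row vector with entry `f` at `l` and `0` elsewhere. -/
def single (l : Fin N) : TwistedPoly Fq R →+ ℰ.motive.carrier :=
  AddMonoidHom.single (fun _ : Fin N => TwistedPoly Fq R) l

/-- The entries of a row vector. -/
def entry (l : Fin N) : ℰ.motive.carrier →+ TwistedPoly Fq R :=
  Pi.evalAddMonoidHom (fun _ : Fin N => TwistedPoly Fq R) l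

theorem entry_single_same (l : Fin N) (f : TwistedPoly Fq R) : ℰ.entry l (ℰ.single l f) = f :=
  Pi.single_eq_same (M := fun _ : Fin N => TwistedPoly Fq R) l f

theorem entry_single_of_ne {l j : Fin N} (h : j ≠ l) (f : TwistedPoly Fq R) :
    ℰ.entry j (ℰ.single l f) = 0 :=
  Pi.single_eq_of_ne (M := fun _ : Fin N => TwistedPoly Fq R) h f

variable {ℰ} in
theorem entry_ext {m m' : ℰ.motive.carrier} (h : ∀ l, ℰ.entry l m = ℰ.entry l m') : m = m' :=
  funext h

/-- Monomial row vectors generate the motive additively, so identities between additive maps need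
only be checked on them. -/
theorem motive_induction {motive : ℰ.motive.carrier → Prop} (m : ℰ.motive.carrier)
    (zero : motive 0) (add : ∀ m m', motive m → motive m' → motive (m + m'))
    (single : ∀ l i x, motive (ℰ.single l (TwistedPoly.monomial Fq i x))) : motive m := by
  have h : ∀ l f, motive (ℰ.single l f) := fun l f => by
    induction f using TwistedPoly.induction with
    | zero => rwa [map_zero]
    | add n r g hg => rw [map_add]; exact add _ _ (single l n r) hg
  have hm : m = ∑ l, ℰ.single l (ℰ.entry l m) :=
    (Finset.univ_sum_single (M := fun _ : Fin N => TwistedPoly Fq R) m).symm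
  rw [hm]
  exact Finset.sum_induction _ _ add zero fun l _ => h l _

theorem entry_tmul_one_smul (x : R) (m : ℰ.motive.carrier) (l : Fin N) :
    ℰ.entry l ((x ⊗ₜ[Fq] (1 : A)) • m) = x • ℰ.entry l m := by
  have h (m : ℰ.Hom) : (x ⊗ₜ[Fq] (1 : A)) • m = x • m := by rw [tmul_smul, one_smul]
  exact congrFun (h m) l

theorem entry_one_tmul_smul (a : A) (m : ℰ.motive.carrier) (l : Fin N) :
    ℰ.entry l (((1 : R) ⊗ₜ[Fq] a) • m) = ∑ j, ℰ.entry j m * ℰ.φ a j l := by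
  have h (m : ℰ.Hom) : ((1 : R) ⊗ₜ[Fq] a) • m = a • m := by rw [tmul_smul, one_smul]
  exact congrFun (h m) l

theorem entry_τ (m : ℰ.motive.carrier) (l : Fin N) :
    ℰ.entry l (ℰ.motive.τ m) = TwistedPoly.tau Fq R * ℰ.entry l m := rfl

theorem tmul_one_smul_single (x : R) (l : Fin N) (f : TwistedPoly Fq R) :
    (x ⊗ₜ[Fq] (1 : A)) • ℰ.single l f = ℰ.single l (x • f) :=
  entry_ext fun j => by
    rw [entry_tmul_one_smul]
    by_cases h : j = l
    · subst h; rw [entry_single_same, entry_single_same]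
    · rw [entry_single_of_ne _ h, entry_single_of_ne _ h, smul_zero]

theorem τ_single (l : Fin N) (f : TwistedPoly Fq R) :
    ℰ.motive.τ (ℰ.single l f) = ℰ.single l (TwistedPoly.tau Fq R * f) :=
  entry_ext fun j => by
    rw [entry_τ]
    by_cases h : j = l
    · subst h; rw [entry_single_same, entry_single_same]
    · rw [entry_single_of_ne _ h, entry_single_of_ne _ h, mul_zero]

/-- The coefficient x stays outside the Frobenius, so every monomial of positive degree is reached
even when R is not perfect. -/
theorem lin_tmul_single (x y : R) (l : Fin N) (i : ℕ) :
    ℰ.motive.lin (TwistedBase.equiv Fq A R (x ⊗ₜ 1) ⊗ₜ[R ⊗[Fq] A]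
      ℰ.single l (TwistedPoly.monomial Fq i y)) =
      ℰ.single l (TwistedPoly.monomial Fq (i + 1) (x * y ^ Fintype.card Fq)) := by
  rw [TauModule.lin_tmul, τ_single, tmul_one_smul_single, TwistedPoly.tau_mul_monomial,
    TwistedPoly.smul_monomial]

/-- The left inverse of the linearization of `τ` that lowers the degree. -/
def linInv : ℰ.motive.carrier →+ ℰ.motive.pullback :=
  -- Constants go to 0, and x τ ^ (i + 1) goes to x ⊗ τ ^ i. Keeping x in the left factor avoids a
  -- q-th root.
  ∑ l, (TwistedPoly.sumHom (fun i => Nat.casesOn i 0 fun i =>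
    ((TensorProduct.mk (R ⊗[Fq] A) (TwistedBase Fq A R) ℰ.motive.carrier).flip
      (ℰ.single l (TwistedPoly.monomial Fq i 1))).toAddMonoidHom.comp
      (((TwistedBase.equiv Fq A R : (R ⊗[Fq] A) →+* TwistedBase Fq A R).comp
        (Algebra.TensorProduct.includeLeftRingHom : R →+* R ⊗[Fq] A) :
        R →+* TwistedBase Fq A R) : R →+ TwistedBase Fq A R))).comp (ℰ.entry l)

theorem linInv_single (l : Fin N) (i : ℕ) (x : R) :
    ℰ.linInv (ℰ.single l (TwistedPoly.monomial Fq (i + 1) x)) =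
      TwistedBase.equiv Fq A R (x ⊗ₜ 1) ⊗ₜ[R ⊗[Fq] A]
        ℰ.single l (TwistedPoly.monomial Fq i 1) := by
  rw [linInv, AddMonoidHom.finsetSum_apply, Finset.sum_eq_single l]
  · rw [AddMonoidHom.comp_apply, entry_single_same, TwistedPoly.sumHom_monomial]
    rfl
  · intro j _ hj
    rw [AddMonoidHom.comp_apply, entry_single_of_ne _ hj, map_zero]
  · exact fun h => absurd (Finset.mem_univ l) h

theorem linInv_lin (x : ℰ.motive.pullback) : ℰ.linInv (ℰ.motive.lin x) = x := by
  have key : ∀ (y : R) (m : ℰ.motive.carrier),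
      ℰ.linInv (ℰ.motive.lin (TwistedBase.equiv Fq A R (y ⊗ₜ 1) ⊗ₜ[R ⊗[Fq] A] m)) =
        TwistedBase.equiv Fq A R (y ⊗ₜ 1) ⊗ₜ[R ⊗[Fq] A] m := fun y m => by
    induction m using motive_induction with
    | zero => rw [TensorProduct.tmul_zero, map_zero, map_zero]
    | add m m' h h' => rw [TensorProduct.tmul_add, map_add, map_add, h, h']
    | single l i x =>
      rw [lin_tmul_single, linInv_single]
      -- Moving the coefficient x of x τ ^ i across the tensor sign turns it into x ^ q, which is
      -- what the linearization produced.
      have h₁ : ℰ.single l (TwistedPoly.monomial Fq i x) =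
          (x ⊗ₜ[Fq] (1 : A)) • ℰ.single l (TwistedPoly.monomial Fq i 1) := by
        rw [tmul_one_smul_single, TwistedPoly.smul_monomial, mul_one]
      rw [h₁, ← TensorProduct.smul_tmul, Algebra.smul_def, TwistedBase.algebraMap_apply, ← map_mul,
        twist_tmul, Algebra.TensorProduct.tmul_mul_tmul, mul_one, mul_comm]
  induction x using TensorProduct.induction_on with
  | zero => rw [map_zero, map_zero]
  | add x y hx hy => rw [map_add, map_add, hx, hy]
  | tmul c m =>
    obtain ⟨c, rfl⟩ := (TwistedBase.equiv Fq A R).surjective c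
    induction c using TensorProduct.induction_on with
    | zero => rw [map_zero, TensorProduct.zero_tmul, map_zero, map_zero]
    | add c c' h h' => rw [map_add, TensorProduct.add_tmul, map_add, map_add, h, h']
    | tmul y a =>
      -- The twist fixes 1 ⊗ a, so a can be moved to the right factor, leaving only scalars from R
      -- on the left.
      have h₁ : TwistedBase.equiv Fq A R (y ⊗ₜ a) =
          ((1 : R) ⊗ₜ[Fq] a) • TwistedBase.equiv Fq A R (y ⊗ₜ 1) := by
        rw [Algebra.smul_def, TwistedBase.algebraMap_apply, ← map_mul, twist_tmul,
          Algebra.TensorProduct.tmul_mul_tmul, one_pow, one_mul, mul_one]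
      rw [h₁, TensorProduct.smul_tmul]
      exact key y _

theorem mem_range_lin {m : ℰ.motive.carrier} (h : ∀ l, (ℰ.entry l m).coeff 0 = 0) :
    m ∈ ℰ.motive.lin.range := by
  -- The vanishing of the constant term does not pass to summands. Subtracting the projection `c`
  -- onto constants gives a claim that is additive in m and holds for all m.
  let c : ℰ.motive.carrier →+ ℰ.motive.carrier := ∑ l, ((ℰ.single l).comp
    (TwistedPoly.monomialHom Fq 0)).comp ((TwistedPoly.coeffHom 0).comp (ℰ.entry l))
  have hc : ∀ m, c m =
      ∑ l, ℰ.single l (TwistedPoly.monomial Fq 0 ((ℰ.entry l m).coeff 0)) := fun m =>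
    AddMonoidHom.finsetSum_apply _ _ _
  have key : ∀ m, m - c m ∈ ℰ.motive.lin.range := fun m => by
    induction m using motive_induction with
    | zero => rw [map_zero, sub_zero]; exact zero_mem _
    | add m m' hm hm' => rw [map_add, add_sub_add_comm]; exact add_mem hm hm'
    | single l i x =>
      rw [hc, Finset.sum_eq_single l, entry_single_same, TwistedPoly.coeff_monomial]
      · cases i with
        | zero => rw [if_pos rfl, sub_self]; exact zero_mem _
        | succ i =>
          refine ⟨TwistedBase.equiv Fq A R (x ⊗ₜ 1) ⊗ₜ[R ⊗[Fq] A]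
            (ℰ.single l (TwistedPoly.monomial Fq i 1)), ?_⟩
          rw [lin_tmul_single, if_neg (Nat.succ_ne_zero i), TwistedPoly.monomial_zero_right,
            map_zero, sub_zero, one_pow, mul_one]
      · intro j _ hj
        rw [entry_single_of_ne _ hj, TwistedPoly.coeff_zero, TwistedPoly.monomial_zero_right,
          map_zero]
      · exact fun h => absurd (Finset.mem_univ l) h
  have hm : c m = 0 := by
    rw [hc]
    exact Finset.sum_eq_zero fun l _ => by
      rw [h, TwistedPoly.monomial_zero_right, map_zero]
  simpa only [hm, sub_zero] using key m

/-- The constant term of (a ⊗ 1 - 1 ⊗ ι(a)) m is m_0 ∂φ_a - ι(a) m_0, which vanishes when ∂φ_a is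
the scalar ι(a). The image is an A_R-submodule, so generators of 𝔧 suffice. -/
theorem idealJ_smul_mem_range_lin
    (hℰ : ∀ a, (ℰ.φ a).map (fun f => f.coeff 0) = Matrix.scalar (Fin N) (algebraMap A R a))
    {y : R ⊗[Fq] A} (hy : y ∈ idealJ Fq A R) (m : ℰ.motive.carrier) :
    y • m ∈ ℰ.motive.lin.range := by
  induction hy using Submodule.span_induction with
  | zero => rw [zero_smul]; exact zero_mem _
  | add y y' _ _ hy hy' => rw [add_smul]; exact add_mem hy hy'
  | smul b y _ hy =>
    obtain ⟨z, hz⟩ := hy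
    refine ⟨TwistedBase.equiv Fq A R b • z, ?_⟩
    rw [TauModule.lin_smul, hz, smul_eq_mul, mul_smul]
  | mem y hy =>
    obtain ⟨a, rfl⟩ := hy
    refine ℰ.mem_range_lin fun l => ?_
    have h₂ : ∀ j, TwistedPoly.constCoeff (ℰ.φ a j l) =
        Matrix.scalar (Fin N) (algebraMap A R a) j l := fun j => by
      rw [← hℰ a, Matrix.map_apply, TwistedPoly.constCoeff_apply]
    rw [sub_smul, map_sub, entry_one_tmul_smul, entry_tmul_one_smul, TwistedPoly.smul_eq,
      ← TwistedPoly.constCoeff_apply, map_sub, map_sum, map_mul,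
      TwistedPoly.constCoeff_apply (TwistedPoly.monomial _ _ _), TwistedPoly.coeff_monomial]
    simp only [map_mul, h₂, Matrix.scalar_apply, Matrix.diagonal_apply]
    simp [mul_comm]

/-- If `∂φ_a` is the scalar `ι(a)`, then `τ` is injective after linearization, and its cokernel is
annihilated by `𝔧`. -/
theorem isMotive {r : ℕ} (hr : ℰ.motive.HasRank r)
    (hℰ : ∀ a, (ℰ.φ a).map (fun f => f.coeff 0) = Matrix.scalar (Fin N) (algebraMap A R a)) :
    ℰ.motive.IsMotive r := by
  -- The kernel is zero, so exponent 0 works there; exponent 1 works for the cokernel.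
  refine ⟨hr, fun x hx => ⟨0, fun y _ => ?_⟩, fun m => ⟨1, fun y hy => ?_⟩⟩
  · rw [← ℰ.linInv_lin x, hx, map_zero, smul_zero]
  · rw [pow_one] at hy
    exact ℰ.idealJ_smul_mem_range_lin hℰ hy m

end AndersonModule

/-! ### Galois descent -/

section Descent

variable {Fq : Type*} [Field Fq] [Fintype Fq]
  {E : Type*} [Field E] [Algebra Fq E]
  {Es : Type*} [Field Es] [Algebra Fq Es] [Algebra E Es] [IsScalarTower Fq E Es]
  {V : Type*} [AddCommGroup V] [Module Fq V]

omit [Fintype Fq] in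
theorem diagAct_smul (ρ : Representation Fq (Es ≃ₐ[E] Es) V) (g : Es ≃ₐ[E] Es) (c : Es)
    (x : Es ⊗[Fq] V) : diagAct ρ g (c • x) = g c • diagAct ρ g x := by
  induction x using TensorProduct.induction_on with
  | zero => simp
  | add x y hx hy => simp only [smul_add, map_add, hx, hy]
  | tmul x v =>
    simp only [TensorProduct.smul_tmul', diagAct_tmul, smul_eq_mul, map_mul]

theorem tensorFrob_smul_top (c : Es) (x : Es ⊗[Fq] V) :
    tensorFrob Fq Es V (c • x) = (c ^ Fintype.card Fq) • tensorFrob Fq Es V x := by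
  induction x using TensorProduct.induction_on with
  | zero => simp
  | add x y hx hy => simp only [smul_add, map_add, hx, hy]
  | tmul x v =>
    simp only [TensorProduct.smul_tmul', tensorFrob_tmul, smul_eq_mul, mul_pow]

/-- Let the Galois group act semilinearly on `X`. Invariants that are linearly independent over `E`
are linearly independent over `Es`. -/
theorem linearIndependent_of_forall_semilinear_eq {E Es X ι : Type*} [Field E] [Field Es]
    [Algebra E Es] [IsGalois E Es] [AddCommMonoid X] [Module E X] [Module Es X]
    [IsScalarTower E Es X] (act : (Es ≃ₐ[E] Es) → X →+ X)
    (hact : ∀ g (c : Es) x, act g (c • x) = g c • act g x)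
    {b : ι → X} (hb : LinearIndependent E b) (hinv : ∀ g i, act g (b i) = b i) :
    LinearIndependent Es b := by
  classical
  let _ : AddCommGroup X := Module.addCommMonoidToAddCommGroup Es
  rw [linearIndependent_iff']
  intro s
  induction s using Finset.induction_on with
  | empty => intro g _ i hi; simp at hi
  | insert a s ha ih =>
    intro g hg
    by_cases h0 : g a = 0
    · rw [Finset.sum_insert ha, h0, zero_smul, zero_add] at hg
      intro i hi
      rcases Finset.mem_insert.1 hi with rfl | hi
      exacts [h0, ih g hg i hi]
    exfalso
    -- Normalize the coefficient at `a` to 1. Applying σ and subtracting then cancels the `a` term,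
    -- and the shorter relation forces every coefficient to be Galois-fixed, hence in E.
    let g' : ι → Es := fun i => (g a)⁻¹ * g i
    have ha' : g' a = 1 := inv_mul_cancel₀ h0
    have hg' : ∑ i ∈ insert a s, g' i • b i = 0 := by
      rw [← smul_zero (g a)⁻¹, ← hg, Finset.smul_sum]
      exact Finset.sum_congr rfl fun i _ => mul_smul _ _ _
    have hfix : ∀ i ∈ s, g' i ∈ Set.range (algebraMap E Es) := fun i hi => by
      rw [InfiniteGalois.mem_range_algebraMap_iff_fixed]
      intro σ
      have h₁ : ∑ i ∈ insert a s, σ (g' i) • b i = 0 := by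
        have := congrArg (act σ) hg'
        rw [map_sum, map_zero] at this
        rw [← this]
        exact Finset.sum_congr rfl fun i _ => by rw [hact, hinv]
      have h₂ : ∑ i ∈ s, (σ (g' i) - g' i) • b i = 0 := by
        rw [Finset.sum_insert ha, ha', map_one] at h₁
        rw [Finset.sum_insert ha, ha'] at hg'
        simp only [sub_smul, Finset.sum_sub_distrib]
        rw [sub_eq_zero]
        exact add_left_cancel (h₁.trans hg'.symm)
      exact sub_eq_zero.1 (ih _ h₂ i hi)
    have : ∀ i, ∃ c : E, i ∈ insert a s → algebraMap E Es c = g' i := fun i => by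
      by_cases hi : i ∈ insert a s
      · rcases Finset.mem_insert.1 hi with rfl | hi
        · exact ⟨1, fun _ => by rw [ha', map_one]⟩
        · obtain ⟨c, hc⟩ := hfix i hi
          exact ⟨c, fun _ => hc⟩
      · exact ⟨0, fun h => absurd h hi⟩
    choose c hc using this
    have hz : ∑ i ∈ insert a s, c i • b i = 0 := by
      rw [← hg']
      exact Finset.sum_congr rfl fun i hi => by rw [← hc i hi, algebraMap_smul]
    have hca := linearIndependent_iff'.1 hb _ _ hz a (Finset.mem_insert_self a s)
    have := hc a (Finset.mem_insert_self a s)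
    rw [hca, map_zero, ha'] at this
    exact zero_ne_one this

omit [Fintype Fq] in
/-- Invariants that are linearly independent over `E` are linearly independent over `Es`. -/
theorem linearIndependent_coe_repD [IsGalois E Es] (ρ : Representation Fq (Es ≃ₐ[E] Es) V)
    {ι : Type*} {b : ι → repD ρ} (hb : LinearIndependent E b) :
    LinearIndependent Es fun i => (b i : Es ⊗[Fq] V) :=
  linearIndependent_of_forall_semilinear_eq (X := Es ⊗[Fq] V)
    (fun g => (diagAct ρ g).toAddMonoidHom) (diagAct_smul ρ)
    (hb.map_injOn (repD ρ).subtype Subtype.val_injective.injOn) fun g i => (b i).2 g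

omit [Fintype Fq] in
/-- The invariants of an Artin representation span `Es ⊗ V`. -/
theorem span_repD_eq_top [IsGalois E Es] (ρ : Representation Fq (Es ≃ₐ[E] Es) V)
    (hρ : IsArtin ρ) : Submodule.span Es (repD ρ : Set (Es ⊗[Fq] V)) = ⊤ := by
  classical
  obtain ⟨L, hfin, hgal, hL⟩ := hρ
  let π : (Es ≃ₐ[E] Es) →* (L ≃ₐ[E] L) := AlgEquiv.restrictNormalHom L
  have hπ : ∀ g (x : L), ((π g x : L) : Es) = g x := fun g x =>
    AlgEquiv.restrictNormal_commutes g L x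
  have hsurj : Function.Surjective π := AlgEquiv.restrictNormalHom_surjective Es
  have hwd : ∀ g g', π g = π g' → ρ g = ρ g' := fun g g' h => by
    have hm : g'⁻¹ * g ∈ L.fixingSubgroup := by
      rw [IntermediateField.mem_fixingSubgroup_iff]
      intro x hx
      have h' := hπ g ⟨x, hx⟩
      rw [h, hπ g' ⟨x, hx⟩] at h'
      change g'.symm (g x) = x
      rw [← h', AlgEquiv.symm_apply_apply]
    rw [← mul_inv_cancel_left g' g, map_mul, hL _ hm, mul_one]
  -- A set-theoretic section is enough: by `hwd`, ρ ∘ s does not depend on the choice and is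
  -- multiplicative.
  let s : (L ≃ₐ[E] L) → (Es ≃ₐ[E] Es) := Function.surjInv hsurj
  have hs : ∀ h, π (s h) = h := Function.surjInv_eq hsurj
  -- The trace of x ⊗ v over Gal(L/E), which is invariant.
  let T : L → V → Es ⊗[Fq] V := fun x v => ∑ h : L ≃ₐ[E] L, ((h x : L) : Es) ⊗ₜ ρ (s h) v
  have hT : ∀ x v, T x v ∈ repD ρ := fun x v g => by
    simp only [T, map_sum, diagAct_tmul]
    refine Fintype.sum_equiv (Equiv.mulLeft (π g)) _ _ fun h => ?_
    have h₁ : ρ (s (π g * h)) = ρ g * ρ (s h) := by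
      rw [← map_mul]
      exact hwd _ _ (by rw [hs, map_mul, hs])
    simp only [Equiv.coe_mulLeft, h₁, AlgEquiv.mul_apply, hπ]
    rfl
  by_contra hne
  -- A functional f killing all invariants kills every trace, so ∑_h f(1 ⊗ ρ(h)v) h(x) = 0 for all x
  -- in L. Independence of the embeddings h kills each coefficient, and h = 1 gives f(1 ⊗ v) = 0.
  obtain ⟨f, hf, hle⟩ := Submodule.exists_le_ker_of_lt_top _ (lt_top_iff_ne_top.2 hne)
  refine hf (LinearMap.ext fun y => ?_)
  induction y using TensorProduct.induction_on with
  | zero => simp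
  | add x y hx hy => simp only [map_add, hx, hy]
  | tmul y v =>
    have h1 : f (1 ⊗ₜ v) = 0 := by
      have hli : LinearIndependent Es fun h : L ≃ₐ[E] L =>
          (L.val.comp (h : L →ₐ[E] L)).toLinearMap :=
        (linearIndependent_toLinearMap E L Es).comp
          (fun h : L ≃ₐ[E] L => L.val.comp (h : L →ₐ[E] L)) fun h h' e => AlgEquiv.ext fun x =>
            Subtype.ext (DFunLike.congr_fun e x)
      have hsum : ∑ h : L ≃ₐ[E] L, f (1 ⊗ₜ ρ (s h) v) •
          (L.val.comp (h : L →ₐ[E] L)).toLinearMap = 0 := by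
        ext x
        have := hle (Submodule.subset_span (hT x v))
        rw [LinearMap.mem_ker, map_sum] at this
        rw [LinearMap.sum_apply, LinearMap.zero_apply, ← this]
        refine Finset.sum_congr rfl fun h _ => ?_
        have h₂ : (((h x : L) : Es) ⊗ₜ[Fq] ρ (s h) v) = ((h x : L) : Es) • (1 ⊗ₜ ρ (s h) v) := by
          rw [TensorProduct.smul_tmul', smul_eq_mul, mul_one]
        rw [h₂, map_smul, smul_eq_mul, mul_comm]
        rfl
      have h₃ := Fintype.linearIndependent_iff.1 hli _ hsum 1
      rwa [hwd (s 1) 1 (by rw [hs, map_one]), map_one] at h₃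
    have h₂ : y ⊗ₜ[Fq] v = y • (1 ⊗ₜ v) := by
      rw [TensorProduct.smul_tmul', smul_eq_mul, mul_one]
    rw [h₂, map_smul, h1, smul_zero, LinearMap.zero_apply]

/-- `D(V)` has an `E`-basis of cardinality `dim V`, which the Frobenius maps to a basis. -/
theorem exists_basis_repD [IsGalois E Es] [FiniteDimensional Fq V]
    (ρ : Representation Fq (Es ≃ₐ[E] Es) V) (hρ : IsArtin ρ) {N : ℕ}
    (hN : Module.finrank Fq V = N) :
    ∃ b : Module.Basis (Fin N) E (repD ρ), LinearIndependent E fun i => repDFrob ρ (b i) := by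
  have hX : Module.finrank Es (Es ⊗[Fq] V) = N := by rw [Module.finrank_baseChange, hN]
  let b := Module.Basis.ofVectorSpace E (repD ρ)
  -- An E-basis of D(V) is thus an Es-basis of Es ⊗ V, which fixes its cardinality.
  have hli := linearIndependent_coe_repD ρ b.linearIndependent
  have hsp : ⊤ ≤ Submodule.span Es (Set.range fun i => (b i : Es ⊗[Fq] V)) := by
    rw [← span_repD_eq_top ρ hρ, Submodule.span_le]
    intro x hx
    have := congrArg (repD ρ).subtype (b.linearCombination_repr ⟨x, hx⟩)
    rw [Finsupp.linearCombination_apply, map_finsuppSum] at this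
    change _ = x at this
    rw [← this]
    refine Submodule.sum_mem _ fun i _ => ?_
    change (b.repr ⟨x, hx⟩ i • (b i : Es ⊗[Fq] V)) ∈ _
    rw [← algebraMap_smul Es]
    exact Submodule.smul_mem _ _ (Submodule.subset_span ⟨i, rfl⟩)
  let bX := Module.Basis.mk hli hsp
  have := Module.Finite.finite_basis bX
  have := Fintype.ofFinite (Module.Basis.ofVectorSpaceIndex E (repD ρ))
  have hcard : Fintype.card (Module.Basis.ofVectorSpaceIndex E (repD ρ)) = N := by
    rw [← hX, Module.finrank_eq_card_basis bX]
  let e := Fintype.equivFinOfCardEq hcard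
  refine ⟨b.reindex e, ?_⟩
  let bN := bX.reindex e
  have hbN : ∀ i, bN i = (b.reindex e i : Es ⊗[Fq] V) := fun i => by
    simp [bN, bX]
  -- Since 1 ⊗ v is fixed by the Frobenius, the Frobenius images of a basis still span; there are N
  -- of them, so they are independent over Es and a fortiori over E.
  have hspan : ⊤ ≤ Submodule.span Es (Set.range fun i => tensorFrob Fq Es V (bN i)) := by
    intro x _
    induction x using TensorProduct.induction_on with
    | zero => exact zero_mem _
    | add x y hx hy => exact add_mem (hx trivial) (hy trivial)
    | tmul y v =>
      have h₂ : y ⊗ₜ[Fq] v = y • tensorFrob Fq Es V (1 ⊗ₜ v) := by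
        rw [tensorFrob_tmul, TensorProduct.smul_tmul', smul_eq_mul, one_pow, mul_one]
      rw [h₂, ← bN.sum_repr (1 ⊗ₜ v), map_sum]
      refine Submodule.smul_mem _ _ (Submodule.sum_mem _ fun i _ => ?_)
      rw [tensorFrob_smul_top]
      exact Submodule.smul_mem _ _ (Submodule.subset_span ⟨i, rfl⟩)
  have hli' : LinearIndependent Es fun i => tensorFrob Fq Es V (bN i) :=
    linearIndependent_of_top_le_span_of_card_eq_finrank hspan (by rw [Fintype.card_fin, hX])
  have hliE : LinearIndependent E fun i => tensorFrob Fq Es V (bN i) :=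
    hli'.restrict_scalars (by
      intro x y h
      simpa [Algebra.smul_def] using h)
  refine LinearIndependent.of_comp (repD ρ).subtype ?_
  convert hliE using 2 with i
  rw [hbN]
  rfl

end Descent

/-! ### Twisting an Anderson module of dimension one by an invertible matrix -/

namespace TwistedPoly

section

variable (Fq : Type*) [Field Fq] [Fintype Fq] {R : Type*} [CommRing R] [Algebra Fq R]
  {n : Type*} [Fintype n] [DecidableEq n]

/-- The matrix `X τ ^ i`. -/
def monomialMatrix (i : ℕ) (X : Matrix n n R) : Matrix n n (TwistedPoly Fq R) :=
  X.map (monomial Fq i)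

omit [DecidableEq n] in
theorem monomialMatrix_mul (i j : ℕ) (X Y : Matrix n n R) :
    monomialMatrix Fq i X * monomialMatrix Fq j Y =
      monomialMatrix Fq (i + j) (X * Y.map ((qFrob Fq R) ^ i : R →+* R)) := by
  have hpow : ∀ x : R, ((qFrob Fq R) ^ i : R →+* R) x = x ^ Fintype.card Fq ^ i :=
    frobAction_smul Fq R i
  ext k l
  simp only [monomialMatrix, Matrix.mul_apply, Matrix.map_apply, monomial_mul_monomial, hpow]
  exact (map_sum (monomialHom Fq (i + j)) _ _).symm

omit [Fintype n] in
theorem monomialMatrix_zero_one : monomialMatrix Fq 0 (1 : Matrix n n R) = 1 := by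
  ext k l
  by_cases h : k = l
  · subst h
    rw [Matrix.one_apply_eq, monomialMatrix, Matrix.map_apply, Matrix.one_apply_eq, one_def]
  · simp [monomialMatrix, h, monomial_zero_right]

/-- The matrices with `(C τ) ^ i = C_i τ ^ i`. -/
def frobProd (C : Matrix n n R) : ℕ → Matrix n n R
  | 0 => 1
  | i + 1 => C * (frobProd C i).map (qFrob Fq R)

theorem isUnit_frobProd {C : Matrix n n R} (hC : IsUnit C) (i : ℕ) :
    IsUnit (frobProd Fq C i) := by
  induction i with
  | zero => exact isUnit_one
  | succ i ih => exact hC.mul (ih.map (qFrob Fq R).mapMatrix)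

theorem monomialMatrix_one_pow (C : Matrix n n R) (i : ℕ) :
    monomialMatrix Fq 1 C ^ i = monomialMatrix Fq i (frobProd Fq C i) := by
  induction i with
  | zero => rw [pow_zero, frobProd, monomialMatrix_zero_one]
  | succ i ih => rw [pow_succ', ih, monomialMatrix_mul, add_comm 1 i, pow_one, frobProd]

/-- The inclusion of the constants. -/
def constHom : R →+* TwistedPoly Fq R where
  toFun := monomial Fq 0
  map_one' := one_def Fq
  map_mul' x y := by rw [monomial_mul_monomial]; simp
  map_zero' := monomial_zero_right Fq 0
  map_add' := monomial_add Fq 0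

theorem scalar_constHom (x : R) : Matrix.scalar n (constHom Fq x) =
    monomialMatrix Fq 0 (Matrix.scalar n x) := by
  ext k l
  by_cases h : k = l
  · subst h
    simp only [monomialMatrix, Matrix.map_apply, Matrix.scalar_apply, Matrix.diagonal_apply_eq]
    rfl
  · simp [monomialMatrix, h, monomial_zero_right]

/-- The ring homomorphism `R[τ] → Mat_n(R[τ])` with `x ↦ x I` and `τ ↦ C τ`. -/
def matrixHom (C : Matrix n n R) : TwistedPoly Fq R →+* Matrix n n (TwistedPoly Fq R) :=
  lift ((Matrix.scalar n).comp (constHom Fq)) (monomialMatrix Fq 1 C) fun x => by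
    rw [RingHom.comp_apply, RingHom.comp_apply, scalar_constHom, scalar_constHom,
      monomialMatrix_mul, monomialMatrix_mul, pow_one, pow_zero]
    congr 1
    ext k l
    simp [qFrob_apply, Matrix.mul_apply, Matrix.diagonal_apply, mul_comm, apply_ite]

variable {Fq}

theorem matrixHom_monomial (C : Matrix n n R) (i : ℕ) (x : R) :
    matrixHom Fq C (monomial Fq i x) = monomialMatrix Fq i (x • frobProd Fq C i) := by
  rw [matrixHom, lift_monomial, RingHom.comp_apply, scalar_constHom, monomialMatrix_one_pow,
    monomialMatrix_mul, zero_add, pow_zero]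
  congr 1
  ext k l
  simp

theorem matrixHom_tau (C : Matrix n n R) :
    matrixHom Fq C (tau Fq R) = monomialMatrix Fq 1 C := by
  rw [tau, matrixHom_monomial, one_smul, frobProd, frobProd]
  simp

/-- Since (Cτ)^i = C_i τ ^ i, the homomorphism never mixes degrees; questions about it reduce to the
matrices C_i over R. -/
theorem coeff_matrixHom (C : Matrix n n R) (f : TwistedPoly Fq R) (i : ℕ) (k l : n) :
    coeff (matrixHom Fq C f k l) i = coeff f i * frobProd Fq C i k l := by
  induction f using induction with
  | zero => rw [map_zero, Matrix.zero_apply, coeff_zero, zero_mul]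
  | add j r g hg =>
    rw [map_add, Matrix.add_apply, coeff_add, hg, coeff_add, add_mul, matrixHom_monomial,
      monomialMatrix, Matrix.map_apply, coeff_monomial, coeff_monomial]
    by_cases h : j = i
    · subst h; simp
    · simp [h]

theorem matrixHom_smul (C : Matrix n n R) (x : R) (f : TwistedPoly Fq R) (k l : n) :
    matrixHom Fq C (x • f) k l = x • matrixHom Fq C f k l := by
  refine ext fun i => ?_
  have hs : ∀ g : TwistedPoly Fq R, coeff (x • g) i = x * coeff g i := fun g => rfl
  rw [coeff_matrixHom, hs, hs, coeff_matrixHom, mul_assoc]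

variable (Fq) in
/-- `matrixHom` as a homomorphism of algebras. -/
def matrixAlgHom (C : Matrix n n R) : TwistedPoly Fq R →ₐ[Fq] Matrix n n (TwistedPoly Fq R) :=
  { matrixHom Fq C with
    commutes' := fun c => by
      change matrixHom Fq C _ = _
      rw [algebraMap_eq, matrixHom_monomial, frobProd, Matrix.algebraMap_eq_diagonal]
      ext k l
      by_cases h : k = l
      · subst h
        rw [monomialMatrix, Matrix.map_apply, Matrix.smul_apply, Matrix.one_apply_eq,
          smul_eq_mul, mul_one, Matrix.diagonal_apply_eq]
        rfl
      · simp [monomialMatrix, h, monomial_zero_right] }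

end

end TwistedPoly

/-! ### The twisted Anderson module and its motive. -/

namespace AndersonModule

variable {Fq : Type*} [Field Fq] [Fintype Fq] {A : Type*} [CommRing A] [Algebra Fq A]
  {R : Type*} [CommRing R] [Algebra Fq R] [Algebra A R] {N : ℕ} (φ : AndersonModule Fq A R 1)

/-- In dimension 1 the nilpotency exponent is 1, so the condition is an equality. -/
theorem coeff_zero_eq (a : A) : (φ.φ a 0 0).coeff 0 = algebraMap A R a := by
  have h := congrFun (congrFun (φ.nilpotent a) 0) 0
  rw [pow_one] at h
  simpa [sub_eq_zero] using h

theorem map_coeff_matrixHom (C : Matrix (Fin N) (Fin N) R) (a : A) :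
    (TwistedPoly.matrixHom Fq C (φ.φ a 0 0)).map (fun f => f.coeff 0) =
      Matrix.scalar (Fin N) (algebraMap A R a) := by
  ext k l
  rw [Matrix.map_apply, TwistedPoly.coeff_matrixHom, coeff_zero_eq, TwistedPoly.frobProd]
  simp [Matrix.one_apply, Matrix.diagonal_apply]

/-- The Anderson module `a ↦ ∑ x_i (C τ) ^ i`, where `φ_a = ∑ x_i τ ^ i`. -/
def matrixTwist (C : Matrix (Fin N) (Fin N) R) : AndersonModule Fq A R N where
  φ := (TwistedPoly.matrixAlgHom Fq C).comp
    (AlgHom.comp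
      { toFun := fun X => X 0 0
        map_one' := rfl
        map_mul' := fun X Y => by simp [Matrix.mul_apply]
        map_zero' := rfl
        map_add' := fun _ _ => rfl
        commutes' := fun c => by simp [Matrix.algebraMap_eq_diagonal] } φ.φ)
  nilpotent a := by
    change ((TwistedPoly.matrixHom Fq C (φ.φ a 0 0)).map (fun f => f.coeff 0) - _) ^ N = 0
    rw [map_coeff_matrixHom, sub_self]
    -- For N = 0 the power 0 ^ 0 is 1, but the matrix ring is trivial.
    cases N with
    | zero => exact Subsingleton.elim _ _
    | succ N => exact zero_pow (Nat.succ_ne_zero N)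

variable {φ} in
theorem matrixTwist_φ (C : Matrix (Fin N) (Fin N) R) (a : A) :
    (φ.matrixTwist C).φ a = TwistedPoly.matrixHom Fq C (φ.φ a 0 0) := rfl

omit [Fintype Fq] [Algebra A R] in
theorem map_smul_of_tmul {M M' : Type*} [AddCommGroup M] [Module (R ⊗[Fq] A) M]
    [AddCommGroup M'] [Module (R ⊗[Fq] A) M'] (f : M →+ M')
    (h₁ : ∀ (x : R) m, f ((x ⊗ₜ[Fq] (1 : A)) • m) = (x ⊗ₜ[Fq] (1 : A)) • f m)
    (h₂ : ∀ (a : A) m, f (((1 : R) ⊗ₜ[Fq] a) • m) = ((1 : R) ⊗ₜ[Fq] a) • f m)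
    (b : R ⊗[Fq] A) (m : M) : f (b • m) = b • f m := by
  induction b using TensorProduct.induction_on with
  | zero => rw [zero_smul, zero_smul, map_zero]
  | add b b' hb hb' => rw [add_smul, map_add, hb, hb', add_smul]
  | tmul x a =>
    have : x ⊗ₜ[Fq] a = (x ⊗ₜ[Fq] (1 : A)) * ((1 : R) ⊗ₜ[Fq] a) := by
      rw [Algebra.TensorProduct.tmul_mul_tmul, mul_one, one_mul]
    rw [this, mul_smul, h₁, h₂, mul_smul]

/-- The map that sends `f` to row `j` of its image under `TwistedPoly.matrixHom`. -/
def rowHom (C : Matrix (Fin N) (Fin N) R) (j : Fin N) :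
    φ.motive.carrier →ₗ[R ⊗[Fq] A] (φ.matrixTwist C).motive.carrier :=
  let f : φ.motive.carrier →+ (φ.matrixTwist C).motive.carrier :=
    { toFun := fun m => (fun l => TwistedPoly.matrixHom Fq C (φ.entry 0 m) j l :
        Fin N → TwistedPoly Fq R)
      map_zero' := funext fun l => by rw [map_zero, map_zero]; rfl
      map_add' := fun m m' => funext fun l => by rw [map_add, map_add]; rfl }
  have hf : ∀ m l, (φ.matrixTwist C).entry l (f m) =
    TwistedPoly.matrixHom Fq C (φ.entry 0 m) j l := fun _ _ => rfl
  { f with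
    map_smul' := map_smul_of_tmul f
      (fun x m => entry_ext fun l => by
        rw [hf, entry_tmul_one_smul, entry_tmul_one_smul, TwistedPoly.matrixHom_smul, hf])
      (fun a m => entry_ext fun l => by
        rw [hf, entry_one_tmul_smul, entry_one_tmul_smul, Fin.sum_univ_one, map_mul,
          Matrix.mul_apply, matrixTwist_φ]
        simp only [hf]) }

theorem entry_rowHom (C : Matrix (Fin N) (Fin N) R) (j l : Fin N) (m : φ.motive.carrier) :
    (φ.matrixTwist C).entry l (φ.rowHom C j m) =
      TwistedPoly.matrixHom Fq C (φ.entry 0 m) j l := rfl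

/-- The map `(m_j) ↦ ∑ rowHom j m_j`. -/
def rowsHom (C : Matrix (Fin N) (Fin N) R) :
    (Fin N → φ.motive.carrier) →ₗ[R ⊗[Fq] A] (φ.matrixTwist C).motive.carrier :=
  ∑ j, (φ.rowHom C j).comp (LinearMap.proj j)

theorem rowsHom_apply (C : Matrix (Fin N) (Fin N) R) (m : Fin N → φ.motive.carrier) :
    φ.rowsHom C m = ∑ j, φ.rowHom C j (m j) := by
  simp [rowsHom]

theorem coeff_entry_rowsHom (C : Matrix (Fin N) (Fin N) R) (m : Fin N → φ.motive.carrier)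
    (i : ℕ) (l : Fin N) :
    ((φ.matrixTwist C).entry l (φ.rowsHom C m)).coeff i =
      Matrix.vecMul (fun j => (φ.entry 0 (m j)).coeff i) (TwistedPoly.frobProd Fq C i) l := by
  rw [rowsHom_apply, map_sum]
  refine (map_sum (TwistedPoly.coeffHom i) _ _).trans ?_
  refine Finset.sum_congr rfl fun j _ => ?_
  exact TwistedPoly.coeff_matrixHom C _ i j l

theorem rowsHom_bijective {C : Matrix (Fin N) (Fin N) R} (hC : IsUnit C) :
    Function.Bijective (φ.rowsHom C) := by
  refine ⟨(injective_iff_map_eq_zero _).2 fun m hm => funext fun j => entry_ext fun k => ?_,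
    fun m => ?_⟩
  · obtain rfl : k = 0 := Subsingleton.elim _ _
    rw [Pi.zero_apply, map_zero]
    refine TwistedPoly.ext fun i => ?_
    have h : Matrix.vecMul (fun j => (φ.entry 0 (m j)).coeff i) (TwistedPoly.frobProd Fq C i) =
        Matrix.vecMul 0 (TwistedPoly.frobProd Fq C i) := funext fun l => by
      rw [← coeff_entry_rowsHom, hm, map_zero, TwistedPoly.coeff_zero, Matrix.zero_vecMul,
        Pi.zero_apply]
    exact congrFun (Matrix.vecMul_injective_of_isUnit (TwistedPoly.isUnit_frobProd Fq hC i) h) j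
  · induction m using motive_induction with
    | zero => exact ⟨0, map_zero _⟩
    | add m m' h h' =>
      obtain ⟨y, rfl⟩ := h
      obtain ⟨y', rfl⟩ := h'
      exact ⟨y + y', map_add _ _ _⟩
    | single l i x =>
      -- With D C_i = 1, the coefficient row x · (row l of D) is carried by C_i to x in position l.
      obtain ⟨D, hD⟩ := (TwistedPoly.isUnit_frobProd Fq hC i).exists_left_inv
      refine ⟨fun j => φ.single 0 (TwistedPoly.monomial Fq i (x * D l j)),
        entry_ext fun k => TwistedPoly.ext fun i' => ?_⟩
      rw [coeff_entry_rowsHom]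
      simp only [entry_single_same, TwistedPoly.coeff_monomial]
      by_cases hi : i = i'
      · subst hi
        have h₁ : Matrix.vecMul (fun j => x * D l j) (TwistedPoly.frobProd Fq C i) k =
            x * (1 : Matrix (Fin N) (Fin N) R) l k := by
          rw [← hD, Matrix.mul_apply, Finset.mul_sum]
          simp only [Matrix.vecMul, dotProduct, mul_assoc]
        simp only [if_true, h₁]
        by_cases hk : k = l
        · subst hk
          rw [entry_single_same, TwistedPoly.coeff_monomial, if_pos rfl, Matrix.one_apply_eq,
            mul_one]
        · rw [entry_single_of_ne _ hk, TwistedPoly.coeff_zero, Matrix.one_apply_ne (Ne.symm hk),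
            mul_zero]
      · simp only [hi, if_false]
        have h0 : Matrix.vecMul (fun _ => (0 : R)) (TwistedPoly.frobProd Fq C i') k = 0 :=
          congrFun (Matrix.zero_vecMul _) k
        rw [h0]
        by_cases hk : k = l
        · subst hk
          rw [entry_single_same, TwistedPoly.coeff_monomial, if_neg hi]
        · rw [entry_single_of_ne _ hk, TwistedPoly.coeff_zero]

/-- Compatibility with τ on m ⊗ b_j: B Ψ(τm) = (B · Cτ) Ψ(m) = τ Ψ(m). This is why the twist uses C
= B⁻¹ rather than B. -/
theorem sum_smul_rowHom_τ {B C : Matrix (Fin N) (Fin N) R} (hBC : B * C = 1) (j : Fin N)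
    (m : φ.motive.carrier) :
    ∑ l, (B j l ⊗ₜ[Fq] (1 : A)) • φ.rowHom C l (φ.motive.τ m) =
      (φ.matrixTwist C).motive.τ (φ.rowHom C j m) := entry_ext fun k => by
  rw [map_sum, entry_τ]
  simp only [entry_tmul_one_smul, entry_rowHom, entry_τ, map_mul, TwistedPoly.matrixHom_tau]
  have h₁ : TwistedPoly.monomialMatrix Fq 0 B * TwistedPoly.monomialMatrix Fq 1 C =
      TwistedPoly.monomialMatrix Fq 1 1 := by
    rw [TwistedPoly.monomialMatrix_mul, zero_add, pow_zero, ← hBC]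
    rfl
  have h₂ : ∑ l, B j l • (TwistedPoly.monomialMatrix Fq 1 C *
      TwistedPoly.matrixHom Fq C (φ.entry 0 m)) l k =
      (TwistedPoly.monomialMatrix Fq 0 B * (TwistedPoly.monomialMatrix Fq 1 C *
      TwistedPoly.matrixHom Fq C (φ.entry 0 m))) j k := by
    rw [Matrix.mul_apply (M := TwistedPoly.monomialMatrix Fq 0 B)]
    exact Finset.sum_congr rfl fun l _ => TwistedPoly.smul_eq Fq _ _
  rw [h₂, ← mul_assoc, h₁, Matrix.mul_apply, Finset.sum_eq_single j]
  · simp [TwistedPoly.monomialMatrix, TwistedPoly.tau]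
  · intro p _ hp
    simp [TwistedPoly.monomialMatrix, Matrix.one_apply_ne (Ne.symm hp),
      TwistedPoly.monomial_zero_right]
  · exact fun h => absurd (Finset.mem_univ j) h

/-- If `P` is free, and `τ` is given on a basis by an invertible matrix over `R` with inverse `C`,
then `M(φ) ⊗ P` is the motive of `φ.matrixTwist C`. -/
theorem tensor_isIso_matrixTwist (P : TauModule.{w} Fq A R)
    (β : Module.Basis (Fin N) (R ⊗[Fq] A) P.carrier) {B C : Matrix (Fin N) (Fin N) R}
    (hβ : ∀ j, P.τ (β j) = ∑ l, (B j l ⊗ₜ[Fq] (1 : A)) • β l) (hBC : B * C = 1) :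
    (φ.motive.tensor P).IsIso (φ.matrixTwist C).motive := by
  have hC : IsUnit C := IsUnit.of_mul_eq_one_right B hBC
  let e : φ.motive.carrier ⊗[R ⊗[Fq] A] P.carrier ≃ₗ[R ⊗[Fq] A]
      (φ.matrixTwist C).motive.carrier :=
    -- Expand along the basis of P to get a tuple of elements of M(φ), then add up the corresponding
    -- rows.
    (TensorProduct.equivFinsuppOfBasisRight β).trans
      ((Finsupp.linearEquivFunOnFinite (R ⊗[Fq] A) φ.motive.carrier (Fin N)).trans
        (LinearEquiv.ofBijective (φ.rowsHom C) (φ.rowsHom_bijective hC)))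
  have he : ∀ m j, e (m ⊗ₜ β j) = φ.rowHom C j m := fun m j => by
    change φ.rowsHom C (Finsupp.linearEquivFunOnFinite (R ⊗[Fq] A) φ.motive.carrier (Fin N)
      (TensorProduct.equivFinsuppOfBasisRight β (m ⊗ₜ β j))) = _
    rw [rowsHom_apply, Finset.sum_eq_single j]
    · simp
    · intro l _ hl
      simp [Finsupp.single_eq_of_ne hl]
    · exact fun h => absurd (Finset.mem_univ j) h
  have hτ : ∀ z : φ.motive.carrier ⊗[R ⊗[Fq] A] P.carrier,
      e (TensorProduct.map φ.motive.τ P.τ z) = (φ.matrixTwist C).motive.τ (e z) := fun z => by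
    obtain ⟨c, rfl⟩ := TensorProduct.eq_repr_basis_right β z
    rw [Finsupp.sum, map_sum, map_sum, map_sum, map_sum]
    refine Finset.sum_congr rfl fun j _ => ?_
    rw [he, TensorProduct.map_tmul, hβ, TensorProduct.tmul_sum, map_sum, ← φ.sum_smul_rowHom_τ hBC]
    refine Finset.sum_congr rfl fun l _ => ?_
    rw [TensorProduct.tmul_smul, map_smul, he]
  exact ⟨e, hτ⟩

end AndersonModule

/-! ### Ranks of tensor products and of free modules, and change of basis. -/

theorem TauModule.HasRank.tensor {Fq : Type*} [Field Fq] [Fintype Fq] {A : Type*} [CommRing A]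
    [Algebra Fq A] {R : Type*} [CommRing R] [Algebra Fq R] {M : TauModule.{v} Fq A R}
    {P : TauModule.{w} Fq A R} {r s : ℕ} (hM : M.HasRank r) (hP : P.HasRank s) :
    (M.tensor P).HasRank (r * s) := by
  obtain ⟨_, _, hMr⟩ := hM
  obtain ⟨_, _, hPr⟩ := hP
  refine ⟨inferInstanceAs (Module.Finite (R ⊗[Fq] A) (M.carrier ⊗[R ⊗[Fq] A] P.carrier)),
    inferInstanceAs (Module.Projective (R ⊗[Fq] A) (M.carrier ⊗[R ⊗[Fq] A] P.carrier)),
    fun p => ?_⟩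
  change Module.rankAtStalk (R := R ⊗[Fq] A) (M.carrier ⊗[R ⊗[Fq] A] P.carrier) p = _
  rw [Module.rankAtStalk_tensorProduct, Pi.mul_apply, hMr, hPr]

theorem TauModule.hasRank_of_basis {Fq : Type*} [Field Fq] [Fintype Fq] {A : Type*} [CommRing A]
    [Algebra Fq A] {R : Type*} [CommRing R] [Algebra Fq R] {P : TauModule.{w} Fq A R} {N : ℕ}
    (β : Module.Basis (Fin N) (R ⊗[Fq] A) P.carrier) : P.HasRank N := by
  have := Module.Free.of_basis β
  have := Module.Finite.of_basis β
  refine ⟨inferInstance, inferInstance, fun p => ?_⟩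
  have : Nontrivial (R ⊗[Fq] A) := p.nontrivial
  rw [Module.rankAtStalk_eq_finrank_of_free, Module.finrank_eq_card_basis β, Fintype.card_fin]
  rfl

theorem Module.Basis.exists_matrix_of_linearIndependent {K D ι : Type*} [Field K] [AddCommMonoid D]
    [Module K D] [Fintype ι] [DecidableEq ι] (b : Module.Basis ι K D) {v : ι → D}
    (hv : LinearIndependent K v) :
    ∃ B C : Matrix ι ι K, B * C = 1 ∧ ∀ j, v j = ∑ l, B j l • b l := by
  let _ : AddCommGroup D := Module.addCommMonoidToAddCommGroup K
  have := Module.Finite.of_basis b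
  let b' : Module.Basis ι K D := Module.Basis.mk hv
    (hv.span_eq_top_of_card_eq_finrank' (Module.finrank_eq_card_basis b).symm).ge
  -- `toMatrix` stores coordinates in columns, whereas the row-vector convention for motives needs
  -- them in rows.
  refine ⟨(b.toMatrix b').transpose, (b'.toMatrix b).transpose, ?_, fun j => ?_⟩
  · rw [← Matrix.transpose_mul, Module.Basis.toMatrix_mul_toMatrix_flip, Matrix.transpose_one]
  · have hj : b' j = v j := Module.Basis.mk_apply _ _ _
    rw [← hj]
    exact (b.sum_toMatrix_smul_self b' j).symm

/-! ### The main theorem -/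

section Main

variable {Fq : Type*} [Field Fq] [Fintype Fq]
  {A : Type*} [CommRing A] [Algebra Fq A]
  {E : Type*} [Field E] [Algebra Fq E]
  {Es : Type*} [Field Es] [Algebra Fq Es] [Algebra E Es] [IsScalarTower Fq E Es]

variable (A) in
/-- The motive of an Artin representation is free, with `τ` given by an invertible matrix. -/
theorem exists_basis_artinMotive [IsGalois E Es] {V : Type*} [AddCommGroup V] [Module Fq V]
    [FiniteDimensional Fq V] (ρ : Representation Fq (Es ≃ₐ[E] Es) V) (hρ : IsArtin ρ) {N : ℕ}
    (hN : Module.finrank Fq V = N) :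
    ∃ (β : Module.Basis (Fin N) (E ⊗[Fq] A) (artinMotive A ρ).carrier)
      (B C : Matrix (Fin N) (Fin N) E), B * C = 1 ∧
      ∀ j, (artinMotive A ρ).τ (β j) = ∑ l, (B j l ⊗ₜ[Fq] (1 : A)) • β l := by
  obtain ⟨b, hb⟩ := exists_basis_repD ρ hρ hN
  obtain ⟨B, C, hBC, hB⟩ := b.exists_matrix_of_linearIndependent hb
  let β : Module.Basis (Fin N) (E ⊗[Fq] A) ((E ⊗[Fq] A) ⊗[E] repD ρ) :=
    Module.Basis.baseChange (E ⊗[Fq] A) b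
  have hβ : ∀ j, β j = 1 ⊗ₜ b j := fun j => Module.Basis.baseChange_apply _ _ _
  refine ⟨β, B, C, hBC, fun j => ?_⟩
  change TensorProduct.map (twistSemilinear Fq E A) (repDFrob ρ) (β j) =
    ∑ l, (B j l ⊗ₜ[Fq] (1 : A)) • β l
  rw [hβ, TensorProduct.map_tmul, hB, TensorProduct.tmul_sum]
  refine Finset.sum_congr rfl fun l _ => ?_
  rw [hβ, TensorProduct.smul_tmul', TensorProduct.tmul_smul, TensorProduct.smul_tmul']
  congr 1
  change B j l • twist Fq A E 1 = (B j l ⊗ₜ[Fq] (1 : A)) * 1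
  rw [map_one, mul_one, Algebra.smul_def, mul_one]
  rfl

/-- The twist of a Drinfeld module by an Artin representation is the motive of an abelian Anderson
module. -/
theorem twistedMotive_isMotive_and_exists_isIso [Algebra A E] [IsGalois E Es] {V : Type*} [AddCommGroup V] [Module Fq V]
    [FiniteDimensional Fq V] (ρ : Representation Fq (Es ≃ₐ[E] Es) V) (hρ : IsArtin ρ) {N : ℕ}
    (hN : Module.finrank Fq V = N) {r : ℕ} (φ : AndersonModule Fq A E 1)
    (hφ : φ.IsAbelianOfRank r) :
    (twistedMotive φ ρ).IsMotive (r * N) ∧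
      ∃ ℰ : AndersonModule Fq A E N, ℰ.IsAbelianOfRank (r * N) ∧
        (twistedMotive φ ρ).IsIso ℰ.motive := by
  obtain ⟨β, B, C, hBC, hβ⟩ := exists_basis_artinMotive A ρ hρ hN
  have hiso : (twistedMotive φ ρ).IsIso (φ.matrixTwist C).motive :=
    φ.tensor_isIso_matrixTwist _ β hβ hBC
  have hrank : (φ.matrixTwist C).motive.HasRank (r * N) :=
    (hφ.tensor (TauModule.hasRank_of_basis β)).of_isIso hiso.symm
  exact ⟨((φ.matrixTwist C).isMotive hrank (φ.map_coeff_matrixHom C)).of_isIso hiso,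
    φ.matrixTwist C, hrank, hiso⟩

omit [Fintype Fq] [Algebra Fq Es] [Algebra Fq E] [IsScalarTower Fq E Es] in
/-- An Artin representation has finitely many matrices, so `Fq(ρ)` is finite over `Fq`. -/
theorem finiteDimensional_coeffField {F : Type*} [Field F] [Algebra Fq F] [Algebra.IsAlgebraic Fq F]
    [Normal E Es] {n : ℕ} (ρ : (Es ≃ₐ[E] Es) →* GL (Fin n) F) (hρ : IsArtin ρ) :
    FiniteDimensional Fq (coeffField Fq ρ) := by
  obtain ⟨L, hfin, -, hL⟩ := hρ
  have hfr : (Set.range ρ).Finite := by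
    -- ρ(g) depends only on the restriction of g to L, and the finite extension L has finitely many
    -- E-embeddings into Es.
    let res : (Es ≃ₐ[E] Es) → (L →ₐ[E] Es) := fun g => (g : Es →ₐ[E] Es).comp L.val
    have hres : ∀ g g', res g = res g' → ρ g = ρ g' := fun g g' h => by
      have hm : g'⁻¹ * g ∈ L.fixingSubgroup := by
        rw [IntermediateField.mem_fixingSubgroup_iff]
        intro x hx
        have h' : g x = g' x := DFunLike.congr_fun h (⟨x, hx⟩ : L)
        change g'.symm (g x) = x
        rw [h', AlgEquiv.symm_apply_apply]
      rw [← mul_inv_cancel_left g' g, map_mul, hL _ hm, mul_one]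
    have : Set.range ρ ⊆ Set.range fun σ : Set.range res => ρ σ.2.choose := by
      rintro _ ⟨g, rfl⟩
      exact ⟨⟨res g, g, rfl⟩, hres _ _ (Set.mem_range_self (f := res) g).choose_spec⟩
    exact (Set.finite_range _).subset this
  have hS : {x | ∃ g i j, x = (ρ g : Matrix (Fin n) (Fin n) F) i j}.Finite := by
    have h : {x | ∃ g i j, x = (ρ g : Matrix (Fin n) (Fin n) F) i j} ⊆
        ⋃ M ∈ Set.range ρ, Set.range fun p : Fin n × Fin n =>
          (M : Matrix (Fin n) (Fin n) F) p.1 p.2 := by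
      rintro _ ⟨g, i, j, rfl⟩
      exact Set.mem_biUnion (Set.mem_range_self g) ⟨(i, j), rfl⟩
    exact (hfr.biUnion fun M _ => Set.finite_range _).subset h
  have := hS.to_subtype
  exact IntermediateField.finiteDimensional_adjoin fun x _ =>
    (Algebra.IsAlgebraic.isAlgebraic x).isIntegral

end Main

end

theorem theoremA
    {Fq : Type*} [Field Fq] [Fintype Fq]
    {A : Type*} [CommRing A] [Algebra Fq A] (hA : IsCurveRing Fq A)
    {E : Type*} [Field E] [Algebra Fq E] [Algebra A E] [IsScalarTower Fq A E]
    {Es : Type*} [Field Es] [Algebra Fq Es] [Algebra E Es] [IsScalarTower Fq E Es]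
    [IsSepClosure E Es]
    (r : ℕ) (φ : AndersonModule Fq A E 1) (hφ : φ.IsAbelianOfRank r) :
    -- representations over a finite extension `k` of degree `d` of `Fq`
    (∀ {k : Type*} [Field k] [Algebra Fq k] [FiniteDimensional Fq k]
        {W : Type*} [AddCommGroup W] [Module k W] [Module Fq W] [IsScalarTower Fq k W]
        [FiniteDimensional k W]
        (ρ : Representation k (Es ≃ₐ[E] Es) W) (_ : IsArtin ρ)
        (n d : ℕ) (_ : Module.finrank k W = n) (_ : Module.finrank Fq k = d),
        (twistedMotive φ (resRep Fq ρ)).IsMotive (r * (n * d)) ∧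
        ∃ ℰ : AndersonModule Fq A E (n * d),
          ℰ.IsAbelianOfRank (r * (n * d)) ∧
          (twistedMotive φ (resRep Fq ρ)).IsIso ℰ.motive) ∧
    -- representations over an algebraic closure of `Fq`, with `d = [Fq(ρ) : Fq]`
    (∀ {F : Type*} [Field F] [Algebra Fq F] [IsAlgClosure Fq F]
        (n : ℕ) (ρ : (Es ≃ₐ[E] Es) →* GL (Fin n) F) (_ : IsArtin ρ)
        (d : ℕ) (_ : Module.finrank Fq (coeffField Fq ρ) = d),
        (twistedMotive φ (resRep Fq (coeffRep Fq ρ))).IsMotive (r * (n * d)) ∧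
        ∃ ℰ : AndersonModule Fq A E (n * d),
          ℰ.IsAbelianOfRank (r * (n * d)) ∧
          (twistedMotive φ (resRep Fq (coeffRep Fq ρ))).IsIso ℰ.motive) := by

  have := (IsSepClosure.isGalois : IsGalois E Es)
  refine ⟨?_, ?_⟩
  · intro k _ _ _ W _ _ _ _ _ ρ hρ n d hn hd
    have : FiniteDimensional Fq W := FiniteDimensional.trans Fq k W
    refine twistedMotive_isMotive_and_exists_isIso (resRep Fq ρ) ?_ ?_ φ hφ
    · obtain ⟨L, h₁, h₂, h₃⟩ := hρ
      exact ⟨L, h₁, h₂, fun g hg => LinearMap.ext fun w => LinearMap.congr_fun (h₃ g hg) w⟩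
    · rw [← Module.finrank_mul_finrank Fq k W, hn, hd, mul_comm]
  · intro F _ _ _ n ρ hρ d hd
    have : Algebra.IsAlgebraic Fq F := IsAlgClosure.isAlgebraic
    have := finiteDimensional_coeffField (Fq := Fq) ρ hρ
    refine twistedMotive_isMotive_and_exists_isIso (resRep Fq (coeffRep Fq ρ)) ?_ ?_ φ hφ
    · obtain ⟨L, h₁, h₂, h₃⟩ := hρ
      refine ⟨L, h₁, h₂, fun g hg => LinearMap.ext fun w => ?_⟩
      -- The entries lie in a subfield of F, so triviality of ρ(g) can be tested in F; the same L
      -- therefore works for V_ρ.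
      have : coeffMatrix Fq ρ g = 1 := by
        ext i j
        change (ρ g : Matrix (Fin n) (Fin n) F) i j = _
        rw [h₃ g hg]
        by_cases h : i = j <;> simp [Matrix.one_apply, h]
      change coeffRep Fq ρ g w = w
      rw [coeffRep_apply, this, Matrix.one_mulVec]
    · rw [← Module.finrank_mul_finrank Fq (coeffField Fq ρ), hd, Module.finrank_fin_fun, mul_comm]
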